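/- **Proposition (Explicit $G_\infty$-cohomology).** Let $p$ be an odd prime, $K$ a finite extension of $\mathbf Q_p$ with algebraic closure $\overline K$, and $\pi$ a uniformizer of $K$. Choose $\pi_n,\epsilon_n\in\overline K$ $(n\ge 0)$ such that $\pi_0=\pi$, $\pi_{n+1}^p=\pi_n$, $\epsilon_n$ is a primitive $p^n$-th root of unity, and $\epsilon_{n+1}^p=\epsilon_n$. Put $K_\infty=K(\pi_n:n\ge0)$, $K_{\mathrm{cycl}}=K(\epsilon_n:n\ge 0)$, $L=K_\infty K_{\mathrm{cycl}}$ and $G_\infty=\mathrm{Gal}(L/K)$ with its Krull topology; let $\chi:G_\infty\to\mathbf Z_p^\times$ be the cyclotomic character. Let $\gamma$ be a topological generator of $\mathrm{Gal}(L/K_\infty)$, and let $\tau$ be the topological generator of $\mathrm{Gal}(L/K_{\mathrm{cycl}})$ such that $\tau(\pi_n)=\epsilon_n\pi_n$ for all $n$. Let $M$ be a $p$-adic topological abelian group with a continuous action of $G_\infty$ by additive automorphisms; here "$p$-adic" means that $M$ is Hausdorff, that $0$ has a basis of neighbourhoods consisting of open subgroups, that $p^nm\to0$ for every $m\in M$,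 and that every Cauchy sequence in $M$ converges. Let $H^i(G_\infty,M)$ denote continuous cohomology, computed by continuous inhomogeneous cochains $G_\infty^i\to M$. Then there is an additive automorphism $\delta=\frac{\tau^{\chi(\gamma)}-1}{\tau-1}$ of $M$ such that, for every sequence of integers $a_n>0$ converging to $\chi(\gamma)$ in $\mathbf Z_p$, the operators $1+\tau+\cdots+\tau^{a_n-1}$ converge pointwise to $\delta$. The sequence $$M\xrightarrow{\;f_M\;}M\oplus M\xrightarrow{\;g_M\;}M,\qquad f_M(m)=\big((\gamma-1)m,(\tau-1)m\big),\quad g_M(x,y)=(\tau-1)x+(1-\delta^{-1}\gamma)y,$$ is a complex, and it computes $H^i(G_\infty,M)$ for all $i\ge 0$; explicitly: 1. $H^0(G_\infty,M)=\ker f_M$, the isomorphism being the identity. 2. There is an isomorphism $H^1(G_\infty,M)\xrightarrow{\sim}\ker g_M/\operatorname{im}f_M$, $[c]\mapsto[(c(\gamma),c(\tau))]$. 3. Every class in $H^2(G_\infty,M)$ is represented by a continuous $2$-cocycle $c$ that vanishes on $\mathrm{Gal}(L/K_{\mathrm{cycl}})\times\mathrm{Gal}(L/K_{\mathrm{cycl}})$,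 and there is an isomorphism $H^2(G_\infty,M)\xrightarrow{\sim}\operatorname{coker}g_M$ given by $[c]\mapsto[c(\gamma,\gamma^{-1}\tau\gamma)-c(\tau,\gamma)]$ for every such cocycle $c$. 4. $H^i(G_\infty,M)=0$ for all $i\ge3$. -/

import Mathlib

universe u v w

open Filter Topology

/-! ### Continuous group cohomology by inhomogeneous cochains -/

namespace ContCohomology

section

/-- The standard differential of inhomogeneous cochains,
`(d f)(g₀, …, gₙ) = g₀ • f(g₁, …, gₙ) + ∑ⱼ (-1) ^ (j + 1) f(…, gⱼ gⱼ₊₁, …)`,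
where the summand with `j = n` is `(-1) ^ (n + 1) f(g₀, …, gₙ₋₁)`. -/
def dFun {G M : Type*} [Group G] [AddCommGroup M] [DistribMulAction G M] (n : ℕ)
    (f : (Fin n → G) → M) (g : Fin (n + 1) → G) : M :=
  g 0 • f (fun i => g i.succ) +
    ∑ j : Fin (n + 1), (-1 : ℤ) ^ ((j : ℕ) + 1) • f (Fin.contractNth j (· * ·) g)

theorem dFun_dFun_aux {G M : Type w} [Group G] [AddCommGroup M] [DistribMulAction G M] (n : ℕ)
    (f : (Fin n → G) → M) : dFun (n + 1) (dFun n f) = 0 := by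
  have : SMulCommClass G (ULift.{w} ℤ) M :=
    ⟨fun g k m => by
      change g • (k.down • m) = k.down • (g • m)
      exact smul_comm g k.down m⟩
  have key : ∀ (m : ℕ) (F : (Fin m → G) → M),
      (inhomogeneousCochains.d (Rep.ofDistribMulAction (ULift.{w} ℤ) G M) m).hom F =
        dFun m F := by
    intro m F
    funext g
    refine congrArg (g 0 • F (fun i => g i.succ) + ·) (Finset.sum_congr rfl fun j _ => ?_)
    change ((-1 : ULift.{w} ℤ) ^ ((j : ℕ) + 1)).down • F (Fin.contractNth j (· * ·) g) = _
    rw [ULift.pow_down]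
    rfl
  have h := groupCohomology.inhomogeneousCochains.d_comp_d (n := n)
    (A := Rep.ofDistribMulAction (ULift.{w} ℤ) G M)
  have h' := LinearMap.congr_fun (congrArg ModuleCat.Hom.hom h) f
  rw [← key, ← key]
  exact h'

theorem dFun_up {G : Type u} {M : Type v} [Group G] [AddCommGroup M] [DistribMulAction G M]
    (n : ℕ) (f : (Fin n → G) → M) :
    dFun n (fun x : Fin n → ULift.{v} G => ULift.up.{u} (f fun i => (x i).down)) =
      fun g => ULift.up (dFun n f fun i => (g i).down) := by
  funext g
  have hc : ∀ j : Fin (n + 1), (fun i => (Fin.contractNth j (· * ·) g i).down) =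
      Fin.contractNth j (· * ·) (fun i => (g i).down) := by
    intro j
    funext i
    unfold Fin.contractNth
    split_ifs <;> rfl
  apply ULift.ext
  simp only [dFun, hc]
  exact congrArg (g 0 • f (fun i => (g i.succ).down) + ·)
    (map_sum (AddEquiv.ulift : ULift.{u} M ≃+ M) _ _)

theorem dFun_dFun {G : Type u} {M : Type v} [Group G] [AddCommGroup M] [DistribMulAction G M]
    (n : ℕ) (f : (Fin n → G) → M) : dFun (n + 1) (dFun n f) = 0 := by
  have h := dFun_dFun_aux n
    (fun x : Fin n → ULift.{v} G => ULift.up.{u} (f fun i => (x i).down))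
  rw [dFun_up, dFun_up] at h
  funext g
  exact congrArg ULift.down (congrFun h fun i => ULift.up (g i))

variable (G : Type u) [Group G] [TopologicalSpace G] [IsTopologicalGroup G]
variable (M : Type v) [AddCommGroup M] [TopologicalSpace M] [IsTopologicalAddGroup M]
variable [DistribMulAction G M] [ContinuousSMul G M]

/-- Continuous inhomogeneous `n`-cochains: continuous maps from `G ^ n` to `M`. -/
abbrev Cochain (n : ℕ) : Type _ := C(Fin n → G, M)

theorem continuous_contractNth (n : ℕ) (j : Fin (n + 1)) :
    Continuous (fun g : Fin (n + 1) → G => Fin.contractNth j (· * ·) g) := by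
  refine continuous_pi fun k => ?_
  unfold Fin.contractNth
  split_ifs <;> fun_prop

/-- The standard differential on continuous cochains. -/
def d (n : ℕ) : Cochain G M n →+ Cochain G M (n + 1) where
  toFun f :=
    { toFun := dFun n f
      continuous_toFun := by
        unfold dFun
        refine Continuous.add (by fun_prop) (continuous_finsetSum _ fun j _ => ?_)
        exact (f.continuous.comp (continuous_contractNth G n j)).zsmul _ }
  map_zero' := by
    ext g
    simp [dFun]
  map_add' f f' := by
    ext g
    simp [dFun, Finset.sum_add_distrib, add_add_add_comm]

theorem d_d (n : ℕ) (f : Cochain G M n) : d G M (n + 1) (d G M n f) = 0 := by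
  ext g
  exact congrFun (dFun_dFun n f) g

/-- Continuous `n`-cocycles. -/
def cocycles (n : ℕ) : AddSubgroup (Cochain G M n) := (d G M n).ker

/-- Continuous `n`-coboundaries; there are none but `0` in degree `0`. -/
def coboundaries : (n : ℕ) → AddSubgroup (Cochain G M n)
  | 0 => ⊥
  | n + 1 => (d G M n).range

theorem coboundaries_le_cocycles (n : ℕ) : coboundaries G M n ≤ cocycles G M n := by
  cases n with
  | zero => exact bot_le
  | succ n =>
    rintro _ ⟨f, rfl⟩
    exact d_d G M n f

/-- Continuous group cohomology `Hⁿ(G, M)`. -/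
abbrev H (n : ℕ) : Type _ :=
  cocycles G M n ⧸ (coboundaries G M n).addSubgroupOf (cocycles G M n)

end

variable {G : Type*} [Group G] [TopologicalSpace G] [IsTopologicalGroup G]
variable {M : Type*} [AddCommGroup M] [TopologicalSpace M] [IsTopologicalAddGroup M]
variable [DistribMulAction G M] [ContinuousSMul G M]

/-- The class in `Hⁿ(G, M)` of a continuous `n`-cocycle. -/
def cls {n : ℕ} (c : cocycles G M n) : H G M n := QuotientAddGroup.mk c

end ContCohomology

/-- A topological abelian group is `p`-adic if `p ^ n • m → 0` for every `m` and every Cauchy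
sequence converges. For a Hausdorff group in which `0` has a basis of neighbourhoods consisting of
open subgroups, the `ℤ`-module structure then extends to a topological `ℤ_p`-module structure. -/
structure IsPadicModule (p : ℕ) (M : Type*) [AddCommGroup M] [TopologicalSpace M] : Prop where
  tendsto_pow_nsmul : ∀ m : M, Tendsto (fun n : ℕ => p ^ n • m) atTop (𝓝 0)
  cauchySeq_tendsto : ∀ u : ℕ → M,
    (∀ U ∈ 𝓝 (0 : M), ∃ N : ℕ, ∀ i ≥ N, ∀ j ≥ N, u i - u j ∈ U) →
      ∃ m : M, Tendsto u atTop (𝓝 m)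

/-! ### The false Tate extension -/

namespace FalseTate

section

variable (K : Type*) [Field K] {Ω : Type*} [Field Ω] [Algebra K Ω]

/-- The field `K_∞ = K(π₀, π₁, π₂, …)`. -/
def kummerField (ϖ : ℕ → Ω) : IntermediateField K Ω :=
  IntermediateField.adjoin K (Set.range ϖ)

/-- The field `K_cycl = K(ε₀, ε₁, ε₂, …)`. -/
def cyclField (ε : ℕ → Ω) : IntermediateField K Ω :=
  IntermediateField.adjoin K (Set.range ε)

/-- The field `L = K_∞ · K_cycl`. -/
def field (ϖ ε : ℕ → Ω) : IntermediateField K Ω :=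
  kummerField K ϖ ⊔ cyclField K ε

/-- The group `G_∞ = Gal(L/K)`, with the Krull topology. -/
abbrev Ginf (ϖ ε : ℕ → Ω) : Type _ := field K ϖ ε ≃ₐ[K] field K ϖ ε

/-- The subgroup `Gal(L/K_∞)` of `G_∞`. -/
def galKummer (ϖ ε : ℕ → Ω) : Subgroup (Ginf K ϖ ε) :=
  (IntermediateField.restrict
    (le_sup_left : kummerField K ϖ ≤ field K ϖ ε)).fixingSubgroup

/-- The subgroup `Gal(L/K_cycl)` of `G_∞`. -/
def galCycl (ϖ ε : ℕ → Ω) : Subgroup (Ginf K ϖ ε) :=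
  (IntermediateField.restrict
    (le_sup_right : cyclField K ε ≤ field K ϖ ε)).fixingSubgroup

variable {K}

/-- The `p`-adic cyclotomic character of `G_∞`. -/
noncomputable def chi (p : ℕ) [Fact p.Prime] {ϖ ε : ℕ → Ω} (g : Ginf K ϖ ε) : ℤ_[p]ˣ :=
  cyclotomicCharacter (field K ϖ ε) p g.toRingEquiv

end

/-! ### The three-term complex -/

section

variable {G : Type*} [Group G] {M : Type*} [AddCommGroup M] [DistribMulAction G M]

/-- `f_M : M → M ⊕ M`, `m ↦ ((γ - 1) m, (τ - 1) m)`. -/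
def fMap (M : Type*) [AddCommGroup M] [DistribMulAction G M] (γ τ : G) : M →+ M × M where
  toFun m := (γ • m - m, τ • m - m)
  map_zero' := by simp
  map_add' a b := by
    ext <;> simp <;> abel

/-- `g_M : M ⊕ M → M`, `(x, y) ↦ (τ - 1) x + (1 - δ⁻¹ γ) y`. -/
def gMap (γ τ : G) (δ : M ≃+ M) : M × M →+ M where
  toFun x := (τ • x.1 - x.1) + (x.2 - δ.symm (γ • x.2))
  map_zero' := by simp
  map_add' a b := by
    simp
    abel

/-- `δ` is the operator `(τ ^ a - 1) / (τ - 1)`: the pointwise limit of the operators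
`1 + τ + ⋯ + τ ^ (aₙ - 1)` for every sequence of positive integers `aₙ` converging to `a` in
`ℤ_p`. -/
def IsNormOperator (p : ℕ) [Fact p.Prime] [TopologicalSpace M] (τ : G) (a : ℤ_[p])
    (δ : M → M) : Prop :=
  ∀ s : ℕ → ℕ, (∀ n, 0 < s n) → Tendsto (fun n => (s n : ℤ_[p])) atTop (𝓝 a) →
    ∀ m : M, Tendsto (fun n => ∑ i ∈ Finset.range (s n), τ ^ i • m) atTop (𝓝 (δ m))

end

end FalseTate

/-! The group is a product `G = N H` of procyclic closed subgroups, with `N = Gal(L/K_cycl)` normal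
and generated by `τ`, `H = Gal(L/K_∞)` generated by `γ`, and `N ∩ H` trivial. Both generators have
order divisible by `p ^ ∞`: `σ ^ n → 1` forces `n → 0` `p`-adically (`IsPadicGenerator`). Since `M`
is `p`-adic, the partial sums `m + σ m + ⋯ + σ ^ (n - 1) m` then extend continuously from the powers
of `σ` to their closure. So a continuous crossed homomorphism on `N` or `H` is the same thing as its
value at the generator, and that value is arbitrary (`exists_isCrossedHom`).

As `γ τ γ⁻¹ = τ ^ χ(γ)` is another generator of `N`, passing from the value at `τ` to the value at
`γ τ γ⁻¹` is an automorphism of `M`. This is `δ` (`normOp`), and its description as a limit of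
partial sums is continuity of the crossed homomorphism. Conjugation by `γ` gives `δ⁻¹ γ c(τ) = γ
c(γ⁻¹ τ γ)`. Hence `g_M(c(γ), c(τ)) = 0` says that `c(τ γ)` is the same whether `τ γ` is read as `τ
· γ` or as `γ · γ⁻¹ τ γ`. This is exactly the condition for crossed homomorphisms on `N` and on `H`
to glue to one on `G` (`exists_crossedHom`), which settles degree `1`.

Higher degrees are reached by dimension shifting along `0 → M → C(G, M) → Shift → 0`, whose terms
are again `p`-adic modules and whose projection has a continuous additive section. A `2`-cocycle `c`
becomes the boundary of a `1`-cochain `F` with values in `C(G, M)`. The image of `F` in `Shift` is a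
crossed homomorphism, so `g(F(γ), F(τ))` lies in `M`, and up to sign it is the class of `c` in
`coker g_M` (`twoHom`). Everything rests on `τ - 1` being surjective on `C(G, M)`
(`exists_smul_sub_eq_coind`): this yields surjectivity of `twoHom`, and `coker g = 0` on `Shift`.
Thus `H²(G, Shift) = 0`, and shifting kills all degrees from `3` on.

The arithmetic input is that `G_∞` has this shape (`isFalseTatePair`). The delicate point is `p ^ ∞`
dividing the order of `γ`, which follows from the unbounded degrees of `p`-power roots of unity over
`K`. -/

set_option linter.unusedSectionVars false

/-! ### Crossed homomorphisms -/

/-- A crossed homomorphism `G → M`. -/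
def IsCrossedHom {G M : Type*} [Group G] [AddCommGroup M] [DistribMulAction G M]
    (c : G → M) : Prop :=
  ∀ a b, c (a * b) = c a + a • c b

namespace IsCrossedHom

variable {G M M' : Type*} [Group G] [AddCommGroup M] [DistribMulAction G M]
  [AddCommGroup M'] [DistribMulAction G M'] {c c' : G → M}

theorem map_one (hc : IsCrossedHom c) : c 1 = 0 := by
  have h := hc 1 1
  simpa using h

theorem map_inv (hc : IsCrossedHom c) (a : G) : c a⁻¹ = -(a⁻¹ • c a) := by
  have h := hc a⁻¹ a
  rw [inv_mul_cancel, hc.map_one] at h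
  exact eq_neg_of_add_eq_zero_left h.symm

theorem add (hc : IsCrossedHom c) (hc' : IsCrossedHom c') : IsCrossedHom (c + c') := fun a b => by
  simp only [Pi.add_apply, hc a b, hc' a b, smul_add]
  abel

theorem sub (hc : IsCrossedHom c) (hc' : IsCrossedHom c') : IsCrossedHom (c - c') := fun a b => by
  simp only [Pi.sub_apply, hc a b, hc' a b, smul_sub]
  abel

theorem comp_addMonoidHom (hc : IsCrossedHom c) (φ : M →+ M')
    (hφ : ∀ (g : G) m, φ (g • m) = g • φ m) : IsCrossedHom (φ ∘ c) := fun a b => by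
  simp only [Function.comp_apply, hc a b, map_add, hφ]

theorem coboundary (m : M) : IsCrossedHom (fun g : G => g • m - m) := fun a b => by
  simp only [mul_smul, smul_sub]
  abel

theorem restrict (hc : IsCrossedHom c) (N : Subgroup G) : IsCrossedHom (fun n : N => c n) :=
  fun a b => hc a b

/-- The subgroup on which a crossed homomorphism vanishes. -/
def zeros (hc : IsCrossedHom c) : Subgroup G where
  carrier := {g | c g = 0}
  mul_mem' {a b} ha hb := by
    change c _ = 0
    rw [hc, show c a = 0 from ha, show c b = 0 from hb, smul_zero, add_zero]
  one_mem' := hc.map_one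
  inv_mem' {a} ha := by
    change c _ = 0
    rw [hc.map_inv, show c a = 0 from ha, smul_zero, neg_zero]

theorem mem_zeros (hc : IsCrossedHom c) {g : G} : g ∈ hc.zeros ↔ c g = 0 := Iff.rfl

variable [TopologicalSpace G] [TopologicalSpace M] [T2Space M]

theorem isClosed_zeros (hc : IsCrossedHom c) (h : Continuous c) :
    IsClosed (hc.zeros : Set G) :=
  isClosed_eq h continuous_const

/-- The zeros of the difference form a subgroup; it contains `σ`, hence all its powers, and these
are dense. -/
theorem ext_of_dense (hc : IsCrossedHom c) (hc' : IsCrossedHom c') (h : Continuous c)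
    (h' : Continuous c') {σ : G} (hσ : DenseRange fun n : ℤ => σ ^ n) (hcc : c σ = c' σ) :
    c = c' := by
  have hsub := hc.sub hc'
  have h0 : σ ∈ hsub.zeros := by
    rw [mem_zeros, Pi.sub_apply, hcc, sub_self]
  refine h.ext_on hσ h' ?_
  rintro _ ⟨n, rfl⟩
  exact sub_eq_zero.1 (hsub.zeros.zpow_mem h0 n)

end IsCrossedHom

/-! ### Stable open subgroups -/

section StableSubgroups

/-- Intersect all translates of an open subgroup `V ⊆ W`. Compactness of `G` (the tube lemma) keeps
this intersection a neighbourhood of `0`. -/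
theorem exists_stable_open_addSubgroup (G : Type*) {M : Type*} [Group G] [TopologicalSpace G]
    [CompactSpace G] [AddCommGroup M] [TopologicalSpace M] [NonarchimedeanAddGroup M]
    [DistribMulAction G M] [ContinuousSMul G M] {W : Set M} (hW : W ∈ 𝓝 (0 : M)) :
    ∃ U : AddSubgroup M, IsOpen (U : Set M) ∧ (U : Set M) ⊆ W ∧ ∀ (g : G), ∀ m ∈ U, g • m ∈ U := by
  obtain ⟨V, hV⟩ := NonarchimedeanAddGroup.is_nonarchimedean W hW
  let U : AddSubgroup M :=
    { carrier := {m | ∀ g : G, g • m ∈ V}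
      add_mem' := fun ha hb g => by rw [smul_add]; exact V.add_mem (ha g) (hb g)
      zero_mem' := fun g => by rw [smul_zero]; exact V.zero_mem
      neg_mem' := fun ha g => by rw [smul_neg]; exact V.neg_mem (ha g) }
  refine ⟨U, AddSubgroup.isOpen_of_mem_nhds U (g := 0) ?_, fun m hm => hV ?_, fun g m hm g' => ?_⟩
  · have h := isCompact_univ (X := G) |>.eventually_forall_of_forall_eventually (x₀ := (0 : M))
      (P := fun m g => g • m ∈ V) (fun g _ => by
        have hc : Continuous fun x : M × G => x.2 • x.1 := by fun_prop
        have h0 : (fun x : M × G => x.2 • x.1) (0, g) ∈ (V : Set M) := by simp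
        exact hc.continuousAt.preimage_mem_nhds (V.isOpen.mem_nhds h0))
    filter_upwards [h] with m hm g
    exact hm g trivial
  · simpa using hm 1
  · rw [← mul_smul]
    exact hm _

end StableSubgroups

/-! ### Crossed homomorphisms on a procyclic group -/

section Existence

variable {P M : Type*} [Group P] [AddCommGroup M] [DistribMulAction P M]

/-- The affine map `x ↦ σ • x + m`. -/
def affinePerm (σ : P) (m : M) : Equiv.Perm M where
  toFun x := σ • x + m
  invFun x := σ⁻¹ • (x - m)
  left_inv x := by simp
  right_inv x := by simp

/-- The value at `σ ^ n` of the crossed homomorphism that takes the value `m` at `σ`. -/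
def zpowSum (σ : P) (m : M) (n : ℤ) : M := (affinePerm σ m ^ n) 0

/-- The linear part of the `n`-th power of an affine map is the `n`-th power of its linear part. At
`y = 0` this is the cocycle identity for `zpowSum`, for negative exponents too. -/
theorem affinePerm_zpow_add (σ : P) (m : M) (n : ℤ) (x y : M) :
    (affinePerm σ m ^ n) (x + y) = σ ^ n • x + (affinePerm σ m ^ n) y := by
  have h : ∀ x y, affinePerm σ m (x + y) = σ • x + affinePerm σ m y := fun x y => by
    simp [affinePerm, add_assoc]
  have h' : ∀ x y, (affinePerm σ m)⁻¹ (x + y) = σ⁻¹ • x + (affinePerm σ m)⁻¹ y := fun x y => by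
    rw [Equiv.Perm.inv_eq_iff_eq, h]
    simp
  induction n generalizing x y with
  | zero => simp
  | succ n ih =>
    rw [zpow_add_one, zpow_add_one, Equiv.Perm.mul_apply, Equiv.Perm.mul_apply, h, ih, mul_smul]
  | pred n ih =>
    rw [zpow_sub_one, zpow_sub_one, Equiv.Perm.mul_apply, Equiv.Perm.mul_apply, h', ih, mul_smul]

theorem zpowSum_one (σ : P) (m : M) : zpowSum σ m 1 = m := by
  simp [zpowSum, affinePerm]

theorem zpowSum_zero (σ : P) (m : M) : zpowSum σ m 0 = 0 := by
  simp [zpowSum]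

theorem zpowSum_add (σ : P) (m : M) (a b : ℤ) :
    zpowSum σ m (a + b) = zpowSum σ m a + σ ^ a • zpowSum σ m b := by
  have h := affinePerm_zpow_add σ m a (zpowSum σ m b) 0
  rw [add_zero] at h
  rw [add_comm (zpowSum σ m a), zpowSum, zpow_add, Equiv.Perm.mul_apply]
  exact h

theorem zpowSum_add_one (σ : P) (m : M) (a : ℤ) :
    zpowSum σ m (a + 1) = zpowSum σ m a + σ ^ a • m := by
  rw [zpowSum_add, zpowSum_one]

theorem zpowSum_natCast (σ : P) (m : M) (n : ℕ) :
    zpowSum σ m n = ∑ i ∈ Finset.range n, σ ^ i • m := by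
  induction n with
  | zero => simp [zpowSum_zero]
  | succ n ih => rw [Nat.cast_succ, zpowSum_add_one, ih, Finset.sum_range_succ, zpow_natCast]

theorem IsCrossedHom.apply_zpow {c : P → M} (hc : IsCrossedHom c) (σ : P) (n : ℤ) :
    c (σ ^ n) = zpowSum σ (c σ) n := by
  induction n with
  | zero => simp [zpowSum_zero, hc.map_one]
  | succ n ih => rw [zpow_add_one, hc, ih, zpowSum_add_one]
  | pred n ih =>
    have h := zpowSum_add_one σ (c σ) (-(n : ℤ) - 1)
    have h' := hc (σ ^ (-(n : ℤ) - 1)) σ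
    rw [sub_add_cancel] at h
    rw [← zpow_add_one, sub_add_cancel, ih, h] at h'
    exact (add_right_cancel h').symm

/-- If `U` is stable and `σ ^ r` fixes `m` modulo `U`, then `zpowSum σ m` is additive modulo `U` on
multiples of `r`. -/
theorem zpowSum_mul_sub_mem {U : AddSubgroup M} (hU : ∀ (g : P), ∀ m ∈ U, g • m ∈ U) {σ : P}
    {m : M} {r : ℤ} (hr : σ ^ r • m - m ∈ U) (q : ℤ) :
    zpowSum σ m (r * q) - q • zpowSum σ m r ∈ U := by
  -- Every summand `σ ^ i m` is fixed by `σ ^ r` modulo `U`, because powers of `σ` commute and `U`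
  -- is stable.
  have key : ∀ k : ℤ, σ ^ r • zpowSum σ m k - zpowSum σ m k ∈ U := by
    intro k
    have step : ∀ k : ℤ, σ ^ r • zpowSum σ m (k + 1) - zpowSum σ m (k + 1) =
        (σ ^ r • zpowSum σ m k - zpowSum σ m k) + σ ^ k • (σ ^ r • m - m) := by
      intro k
      rw [zpowSum_add_one, smul_add, smul_sub, ← mul_smul, ← mul_smul, ← zpow_add, ← zpow_add,
        add_comm r k]
      abel
    induction k with
    | zero => simp [zpowSum_zero]
    | succ n ih =>
      rw [step]
      exact U.add_mem ih (hU _ _ hr)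
    | pred n ih =>
      have h := step (-(n : ℤ) - 1)
      rw [sub_add_cancel] at h
      rw [h] at ih
      exact (U.add_mem_cancel_right (hU _ _ hr)).1 ih
  have step : ∀ q : ℤ, zpowSum σ m (r * (q + 1)) - (q + 1) • zpowSum σ m r =
      (zpowSum σ m (r * q) - q • zpowSum σ m r) +
        (σ ^ r • zpowSum σ m (r * q) - zpowSum σ m (r * q)) := by
    intro q
    rw [mul_add, mul_one, add_comm (r * q) r, zpowSum_add, add_smul, one_smul]
    abel
  induction q with
  | zero => simp [zpowSum_zero]
  | succ n ih =>
    rw [step]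
    exact U.add_mem ih (key _)
  | pred n ih =>
    have h := step (-(n : ℤ) - 1)
    rw [sub_add_cancel] at h
    rw [h] at ih
    exact (U.add_mem_cancel_right (key _)).1 ih

variable [TopologicalSpace P]

/-- The powers of `σ` tend to `1` only along exponents that tend to `0` `p`-adically. -/
def IsPadicGenerator (p : ℕ) (σ : P) : Prop :=
  ∀ j : ℕ, ∃ W ∈ 𝓝 (1 : P), ∀ n : ℤ, σ ^ n ∈ W → ((p ^ j : ℕ) : ℤ) ∣ n

variable [IsTopologicalGroup P] [CompactSpace P] [FirstCountableTopology P]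
  [TopologicalSpace M] [NonarchimedeanAddGroup M] [ContinuousSMul P M]

/-- Recurrence in a compact group: along a convergent subsequence of powers, the quotients of late
terms approach `1`. -/
theorem exists_pos_zpow_mem (σ : P) {V : Set P} (hV : V ∈ 𝓝 (1 : P)) :
    ∃ r : ℕ, 0 < r ∧ σ ^ r ∈ V := by
  obtain ⟨x, φ, hφ, hx⟩ := CompactSpace.tendsto_subseq (fun n : ℕ => σ ^ n)
  have h : Tendsto (fun k : ℕ × ℕ => (σ ^ φ k.1)⁻¹ * σ ^ φ k.2) (atTop ×ˢ atTop)
      (𝓝 (x⁻¹ * x)) :=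
    ((hx.comp tendsto_fst).inv).mul (hx.comp tendsto_snd)
  rw [inv_mul_cancel] at h
  have h1 := h.eventually hV
  rw [prod_atTop_atTop_eq, eventually_atTop] at h1
  obtain ⟨⟨a, b⟩, hab⟩ := h1
  have h2 := hab (max a b, max a b + 1) ⟨le_max_left _ _, (le_max_right _ _).trans (Nat.le_succ _)⟩
  have hlt : φ (max a b) < φ (max a b + 1) := hφ (Nat.lt_succ_self _)
  refine ⟨φ (max a b + 1) - φ (max a b), Nat.sub_pos_of_lt hlt, ?_⟩
  obtain ⟨d, hd⟩ := Nat.exists_eq_add_of_lt hlt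
  simp only at h2
  rw [hd] at h2 ⊢
  rw [show φ (max a b) + d + 1 - φ (max a b) = d + 1 by omega]
  rw [add_assoc, pow_add, inv_mul_cancel_left] at h2
  exact h2

variable {p : ℕ} [Fact p.Prime]

/-- The exponents `n` with `σ ^ n ∈ V` form a subgroup `rℤ`, nonzero by recurrence. The part of `r`
prime to `p` is controlled by `V` itself and the `p`-part by `IsPadicGenerator`, so `σ` may have a
finite prime-to-`p` component. -/
theorem exists_nhds_one_dvd {σ : P} (hσ : IsPadicGenerator p σ) {V : Subgroup P}
    (hV : IsOpen (V : Set P)) :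
    ∃ r : ℤ, σ ^ r ∈ V ∧ ∀ k : ℕ, ∃ W ∈ 𝓝 (1 : P), ∀ n : ℤ, σ ^ n ∈ W →
      (r * (p ^ k : ℕ) : ℤ) ∣ n := by
  obtain ⟨r₀, hr₀, hr₀V⟩ := exists_pos_zpow_mem σ (hV.mem_nhds V.one_mem)
  let R : AddSubgroup ℤ := AddSubgroup.comap (zmultiplesHom (Additive P) (Additive.ofMul σ))
    (Subgroup.toAddSubgroup V)
  have hR : ∀ n : ℤ, n ∈ R ↔ σ ^ n ∈ V := fun n => Iff.rfl
  obtain ⟨r, hr⟩ := Int.subgroup_cyclic R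
  have hmem : ∀ n : ℤ, σ ^ n ∈ V ↔ r ∣ n := fun n => by
    rw [← hR, hr, AddSubgroup.mem_closure_singleton]
    simp only [smul_eq_mul, dvd_def, mul_comm r, eq_comm]
  have hr0 : r ≠ 0 := by
    rintro rfl
    have := (hmem r₀).1 (by simpa using hr₀V)
    rw [zero_dvd_iff] at this
    omega
  refine ⟨r, (hmem r).2 dvd_rfl, fun k => ?_⟩
  have hfin : FiniteMultiplicity (p : ℤ) r := by
    rw [Int.finiteMultiplicity_iff]
    exact ⟨by simpa using (Fact.out : p.Prime).ne_one, hr0⟩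
  obtain ⟨s, hs, hsp⟩ := hfin.exists_eq_pow_mul_and_not_dvd
  set e := multiplicity (p : ℤ) r
  obtain ⟨W, hW, hWn⟩ := hσ (k + e)
  -- With `r = p ^ e * s`, membership in `V` gives `s ∣ n` and membership in `W` gives `p ^ (k + e)
  -- ∣ n`; these are coprime with product `r * p ^ k`.
  refine ⟨W ∩ V, inter_mem hW (hV.mem_nhds V.one_mem), fun n hn => ?_⟩
  have h1 := hWn n hn.1
  have h2 : s ∣ n := (Dvd.intro_left _ hs.symm).trans ((hmem n).1 hn.2)
  have hco : IsCoprime s ((p ^ (k + e) : ℕ) : ℤ) := by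
    push_cast
    exact (((Nat.prime_iff_prime_int.1 (Fact.out : p.Prime)).coprime_iff_not_dvd.2 hsp).symm).pow_right
  have h3 := hco.mul_dvd h2 h1
  have h4 : s * ((p ^ (k + e) : ℕ) : ℤ) = r * (p ^ k : ℕ) := by
    rw [hs]
    push_cast
    ring
  rwa [h4] at h3

/-- Modulo `U` the sum is additive on multiples of a period `r` of `m`, and `p ^ k` times the sum
over one period lies in `U` for large `k`. It remains to force `r * p ^ k ∣ n`. -/
theorem exists_nhds_one_zpowSum_mem (hM : IsPadicModule p M) {σ : P} (hσ : IsPadicGenerator p σ)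
    (m : M) {U : AddSubgroup M} (hUo : IsOpen (U : Set M))
    (hU : ∀ (g : P), ∀ m ∈ U, g • m ∈ U) :
    ∃ W ∈ 𝓝 (1 : P), ∀ n : ℤ, σ ^ n ∈ W → zpowSum σ m n ∈ U := by
  let V : Subgroup P :=
    { carrier := {g | g • m - m ∈ U}
      mul_mem' := fun {a b} ha hb => by
        change (a * b) • m - m ∈ U
        have : (a * b) • m - m = a • (b • m - m) + (a • m - m) := by
          rw [mul_smul, smul_sub]; abel
        rw [this]
        exact U.add_mem (hU _ _ hb) ha
      one_mem' := by
        change (1 : P) • m - m ∈ U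
        simp
      inv_mem' := fun {a} ha => by
        change a⁻¹ • m - m ∈ U
        have : a⁻¹ • m - m = -(a⁻¹ • (a • m - m)) := by
          rw [smul_sub, inv_smul_smul]; abel
        rw [this]
        exact U.neg_mem (hU _ _ ha) }
  have hV : IsOpen (V : Set P) :=
    hUo.preimage (f := fun g : P => g • m - m) (by fun_prop)
  obtain ⟨r, hr, hk⟩ := exists_nhds_one_dvd hσ hV
  obtain ⟨k, hkU⟩ := ((hM.tendsto_pow_nsmul (zpowSum σ m r)).eventually
    (hUo.mem_nhds U.zero_mem)).exists
  obtain ⟨W, hW, hWn⟩ := hk k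
  refine ⟨W, hW, fun n hn => ?_⟩
  obtain ⟨q, rfl⟩ := hWn n hn
  have h := zpowSum_mul_sub_mem hU hr ((p ^ k : ℕ) * q)
  rw [← mul_assoc] at h
  rw [← sub_add_cancel (zpowSum σ m _) ((((p ^ k : ℕ) : ℤ) * q) • zpowSum σ m r)]
  refine U.add_mem h ?_
  rw [mul_comm, mul_smul, natCast_zsmul]
  exact U.zsmul_mem hkU q

/-- The difference equals `σ ^ b • zpowSum σ m (a - b)`, and `σ ^ (a - b) → 1`. Stability of `U`
absorbs the factor `σ ^ b`. -/
theorem tendsto_zpowSum (hM : IsPadicModule p M) {σ : P} (hσ : IsPadicGenerator p σ) (m : M)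
    {ι : Type*} {l : Filter ι} {a b : ι → ℤ} {x : P} (ha : Tendsto (fun i => σ ^ a i) l (𝓝 x))
    (hb : Tendsto (fun i => σ ^ b i) l (𝓝 x)) :
    Tendsto (fun i => zpowSum σ m (a i) - zpowSum σ m (b i)) l (𝓝 0) := by
  intro W hW
  obtain ⟨U, hUo, hUW, hU⟩ := exists_stable_open_addSubgroup P hW
  obtain ⟨V, hV, hVn⟩ := exists_nhds_one_zpowSum_mem hM hσ m hUo hU
  have h : Tendsto (fun i => (σ ^ b i)⁻¹ * σ ^ a i) l (𝓝 (x⁻¹ * x)) := hb.inv.mul ha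
  rw [inv_mul_cancel] at h
  change ∀ᶠ i in l, _ ∈ W
  filter_upwards [h.eventually hV] with i hi
  refine hUW ?_
  have h1 : σ ^ (a i - b i) ∈ V := by
    rw [sub_eq_neg_add, zpow_add, zpow_neg]
    exact hi
  have h2 := zpowSum_add σ m (b i) (a i - b i)
  rw [add_sub_cancel] at h2
  rw [h2, add_sub_cancel_left]
  exact hU _ _ (hVn _ h1)

theorem exists_isCrossedHom [T2Space M] (hM : IsPadicModule p M) {σ : P}
    (hσ : IsPadicGenerator p σ) (hd : DenseRange fun n : ℤ => σ ^ n) (m : M) :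
    ∃ c : P → M, Continuous c ∧ IsCrossedHom c ∧ c σ = m := by
  -- The topology pulled back from `P` makes `n ↦ σ ^ n` dense inducing, so that `zpowSum` can be
  -- extended by continuity.
  let : TopologicalSpace ℤ := TopologicalSpace.induced (fun n : ℤ => σ ^ n) inferInstance
  have hi : IsDenseInducing fun n : ℤ => σ ^ n := ⟨⟨rfl⟩, hd⟩
  have hlim : ∀ x : P, ∃ y, Tendsto (zpowSum σ m) (comap (fun n : ℤ => σ ^ n) (𝓝 x)) (𝓝 y) := by
    intro x
    have := hi.comap_nhds_neBot x
    obtain ⟨a, ha⟩ := (comap (fun n : ℤ => σ ^ n) (𝓝 x)).exists_seq_tendsto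
    have hax : Tendsto (fun k => σ ^ a k) atTop (𝓝 x) := tendsto_comap_iff.1 ha
    obtain ⟨y, hy⟩ := hM.cauchySeq_tendsto (fun k => zpowSum σ m (a k)) fun U hU => by
      have h := (tendsto_zpowSum hM hσ m (hax.comp (tendsto_fst (f := atTop) (g := atTop)))
        (hax.comp (tendsto_snd (f := atTop) (g := atTop)))) hU
      obtain ⟨N, hN⟩ := eventually_atTop.1 (prod_atTop_atTop_eq (α := ℕ) (β := ℕ) ▸ h)
      exact ⟨max N.1 N.2, fun i hi j hj =>
        hN (i, j) ⟨(le_max_left _ _).trans hi, (le_max_right _ _).trans hj⟩⟩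
    -- The filter is countably generated, so sequences suffice, and `tendsto_zpowSum` compares any
    -- of them with the chosen one.
    refine ⟨y, tendsto_of_seq_tendsto fun b hb => ?_⟩
    have := (tendsto_zpowSum hM hσ m (tendsto_comap_iff.1 hb) hax).add hy
    simpa [Function.comp_def] using this
  have hcont := hi.continuous_extend hlim
  have hval : ∀ n : ℤ, hi.extend (zpowSum σ m) (σ ^ n) = zpowSum σ m n := by
    intro n
    refine hi.extend_eq_of_tendsto (b := σ ^ n) ?_
    have := (tendsto_zpowSum hM hσ m (x := σ ^ n) (b := fun _ => n)
      (tendsto_comap (f := fun n : ℤ => σ ^ n)) tendsto_const_nhds).add_const (zpowSum σ m n)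
    simpa using this
  refine ⟨hi.extend (zpowSum σ m), hcont, fun a b => ?_, by simpa [zpowSum_one] using hval 1⟩
  refine hd.induction_on₂ (p := fun a b => hi.extend (zpowSum σ m) (a * b) =
    hi.extend (zpowSum σ m) a + a • hi.extend (zpowSum σ m) b) ?_ (fun k l => ?_) a b
  · exact isClosed_eq (by fun_prop) (by fun_prop)
  · simp only [← zpow_add, hval, zpowSum_add]

end Existence

/-! ### Topologically generated subgroups and conjugation -/

section Subgroup

variable {G M : Type*} [Group G] [TopologicalSpace G] [IsTopologicalGroup G] {p : ℕ}
  {σ : G} {S : Subgroup G}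

theorem mem_of_closure_zpowers_eq (hS : (Subgroup.zpowers σ).topologicalClosure = S) : σ ∈ S :=
  hS ▸ Subgroup.le_topologicalClosure _ (Subgroup.mem_zpowers σ)

theorem isClosed_of_closure_zpowers_eq (hS : (Subgroup.zpowers σ).topologicalClosure = S) :
    IsClosed (S : Set G) :=
  hS ▸ Subgroup.isClosed_topologicalClosure _

theorem denseRange_zpow_of_closure_eq (hS : (Subgroup.zpowers σ).topologicalClosure = S)
    (hσ : σ ∈ S) : DenseRange fun n : ℤ => (⟨σ, hσ⟩ : S) ^ n := by
  intro x
  rw [closure_subtype]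
  have hx : (x : G) ∈ (Subgroup.zpowers σ).topologicalClosure := hS ▸ x.2
  refine closure_mono ?_ hx
  rintro _ ⟨n, rfl⟩
  exact ⟨_, ⟨n, rfl⟩, by simp⟩

omit [IsTopologicalGroup G] in
theorem IsPadicGenerator.subtype (h : IsPadicGenerator p σ) (hσ : σ ∈ S) :
    IsPadicGenerator p (⟨σ, hσ⟩ : S) := fun j => by
  obtain ⟨W, hW, hWn⟩ := h j
  refine ⟨Subtype.val ⁻¹' W, continuous_subtype_val.continuousAt.preimage_mem_nhds hW,
    fun n hn => hWn n ?_⟩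
  simpa using hn

theorem IsPadicGenerator.conj (h : IsPadicGenerator p σ) (g : G) :
    IsPadicGenerator p (g * σ * g⁻¹) := fun j => by
  obtain ⟨W, hW, hWn⟩ := h j
  refine ⟨(fun x => g⁻¹ * x * g) ⁻¹' W, ContinuousAt.preimage_mem_nhds (by fun_prop)
    (by simpa using hW), fun n hn => hWn n ?_⟩
  rw [Set.mem_preimage, conj_zpow] at hn
  simpa [mul_assoc] using hn

theorem closure_zpowers_conj [S.Normal] (hS : (Subgroup.zpowers σ).topologicalClosure = S) (g : G) :
    (Subgroup.zpowers (g * σ * g⁻¹)).topologicalClosure = S := by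
  apply le_antisymm
  · refine Subgroup.topologicalClosure_minimal _ ?_ (isClosed_of_closure_zpowers_eq hS)
    rw [Subgroup.zpowers_le]
    exact Subgroup.Normal.conj_mem inferInstance _ (mem_of_closure_zpowers_eq hS) g
  · set T := (Subgroup.zpowers (g * σ * g⁻¹)).topologicalClosure
    have hT : IsClosed (T : Set G) := Subgroup.isClosed_topologicalClosure _
    have h1 : S ≤ T.comap (MulAut.conj g).toMonoidHom := by
      rw [← hS]
      refine Subgroup.topologicalClosure_minimal _ ?_ (hT.preimage (f := fun x => g * x * g⁻¹)
        (by fun_prop))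
      rw [Subgroup.zpowers_le]
      exact Subgroup.le_topologicalClosure _ (Subgroup.mem_zpowers _)
    intro n hn
    have h2 := h1 (Subgroup.Normal.conj_mem inferInstance n hn g⁻¹)
    simpa [mul_assoc] using h2

variable [CompactSpace G] [FirstCountableTopology G]
  [AddCommGroup M] [TopologicalSpace M] [NonarchimedeanAddGroup M] [T2Space M]
  [DistribMulAction G M] [ContinuousSMul G M]

theorem exists_isCrossedHom_subgroup [Fact p.Prime] (hM : IsPadicModule p M)
    (hS : (Subgroup.zpowers σ).topologicalClosure = S) (hσ : IsPadicGenerator p σ) (hσS : σ ∈ S)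
    (m : M) : ∃ c : S → M, Continuous c ∧ IsCrossedHom c ∧ c ⟨σ, hσS⟩ = m :=
  have : CompactSpace S :=
    isCompact_iff_compactSpace.1 (isClosed_of_closure_zpowers_eq hS).isCompact
  have : FirstCountableTopology S := Topology.IsInducing.subtypeVal.firstCountableTopology
  exists_isCrossedHom hM (hσ.subtype hσS) (denseRange_zpow_of_closure_eq hS hσS) m

end Subgroup

section Conj

variable {G M : Type*} [Group G] [AddCommGroup M] [DistribMulAction G M] {N : Subgroup G}
  [N.Normal] {c : N → M}

theorem IsCrossedHom.conj (hc : IsCrossedHom c) (g : G) :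
    IsCrossedHom fun n : N => g • c (MulAut.conjNormal g⁻¹ n) := fun a b => by
  dsimp only
  rw [map_mul, hc, smul_add]
  simp only [Subgroup.smul_def, MulAut.conjNormal_apply, ← mul_smul]
  congr 2
  simp [mul_assoc]

theorem continuous_conjNormal [TopologicalSpace G] [IsTopologicalGroup G] (g : G) :
    Continuous fun n : N => MulAut.conjNormal g n := by
  refine Continuous.subtype_mk ?_ _
  fun_prop

end Conj

/-! ### The semidirect product, the operator `δ` and degree one -/

/-- A profinite group with a decomposition `G = N ⋊ H`, where `N` and `H` are topologically
generated by `τ` and `γ` and have order divisible by `p ^ ∞`. -/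
structure IsFalseTatePair {G : Type*} [Group G] [TopologicalSpace G] [IsTopologicalGroup G]
    (p : ℕ) (γ τ : G) (N H : Subgroup G) : Prop where
  closure_γ : (Subgroup.zpowers γ).topologicalClosure = H
  closure_τ : (Subgroup.zpowers τ).topologicalClosure = N
  normal : N.Normal
  disjoint : Disjoint N H
  exists_mul : ∀ g : G, ∃ n ∈ N, ∃ h ∈ H, n * h = g
  padic_γ : IsPadicGenerator p γ
  padic_τ : IsPadicGenerator p τ

namespace IsFalseTatePair

variable {G : Type u} [Group G] [TopologicalSpace G] [IsTopologicalGroup G]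
  {p : ℕ} {γ τ : G} {N H : Subgroup G}

theorem γ_mem (hT : IsFalseTatePair p γ τ N H) : γ ∈ H := mem_of_closure_zpowers_eq hT.closure_γ

theorem τ_mem (hT : IsFalseTatePair p γ τ N H) : τ ∈ N := mem_of_closure_zpowers_eq hT.closure_τ

theorem conj_mem (hT : IsFalseTatePair p γ τ N H) (g : G) : g * τ * g⁻¹ ∈ N :=
  hT.normal.conj_mem _ hT.τ_mem g

theorem eq_top (hT : IsFalseTatePair p γ τ N H) {S : Subgroup G} (hS : IsClosed (S : Set G))
    (hγ : γ ∈ S) (hτ : τ ∈ S) : S = ⊤ := by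
  have h1 : N ≤ S := hT.closure_τ ▸ Subgroup.topologicalClosure_minimal _
    (by rwa [Subgroup.zpowers_le]) hS
  have h2 : H ≤ S := hT.closure_γ ▸ Subgroup.topologicalClosure_minimal _
    (by rwa [Subgroup.zpowers_le]) hS
  refine eq_top_iff.2 fun g _ => ?_
  obtain ⟨n, hn, h, hh, rfl⟩ := hT.exists_mul g
  exact S.mul_mem (h1 hn) (h2 hh)

/-- Multiplication `N × H → G` is a continuous bijection from a compact space to a Hausdorff one, so
both coordinates are continuous. -/
theorem exists_decomp [CompactSpace G] [T2Space G] (hT : IsFalseTatePair p γ τ N H) :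
    ∃ (f : G → N) (k : G → H), Continuous f ∧ Continuous k ∧ (∀ g, (f g : G) * k g = g) ∧
      (∀ (n : N) (h : H), f (n * h) = n) ∧ ∀ (n : N) (h : H), k (n * h) = h := by
  have : CompactSpace N := isCompact_iff_compactSpace.1
    (isClosed_of_closure_zpowers_eq hT.closure_τ).isCompact
  have : CompactSpace H := isCompact_iff_compactSpace.1
    (isClosed_of_closure_zpowers_eq hT.closure_γ).isCompact
  let e₀ : N × H ≃ G := Equiv.ofBijective (fun x => (x.1 : G) * x.2)
    ⟨Subgroup.mul_injective_of_disjoint hT.disjoint, fun g => by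
      obtain ⟨n, hn, h, hh, rfl⟩ := hT.exists_mul g
      exact ⟨(⟨n, hn⟩, ⟨h, hh⟩), rfl⟩⟩
  have he₀ : Continuous e₀ := by
    change Continuous fun x : N × H => (x.1 : G) * x.2
    fun_prop
  let e : N × H ≃ₜ G := he₀.homeoOfEquivCompactToT2
  have he : ∀ (n : N) (h : H), e.symm (n * h) = (n, h) := fun n h => e.symm_apply_apply (n, h)
  exact ⟨fun g => (e.symm g).1, fun g => (e.symm g).2, continuous_fst.comp e.symm.continuous,
    continuous_snd.comp e.symm.continuous, fun g => e.apply_symm_apply g,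
    fun n h => by simp [he], fun n h => by simp [he]⟩

variable {M : Type v} [AddCommGroup M] [TopologicalSpace M] [NonarchimedeanAddGroup M] [T2Space M]
  [DistribMulAction G M] [ContinuousSMul G M]
  {M' : Type w} [AddCommGroup M'] [TopologicalSpace M'] [NonarchimedeanAddGroup M'] [T2Space M']
  [DistribMulAction G M'] [ContinuousSMul G M']

omit [NonarchimedeanAddGroup M] [ContinuousSMul G M] in
theorem crossedHom_ext_N (hT : IsFalseTatePair p γ τ N H) {c c' : N → M} (hc : IsCrossedHom c)
    (hc' : IsCrossedHom c') (h : Continuous c) (h' : Continuous c')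
    (heq : c ⟨τ, hT.τ_mem⟩ = c' ⟨τ, hT.τ_mem⟩) : c = c' :=
  hc.ext_of_dense hc' h h' (denseRange_zpow_of_closure_eq hT.closure_τ hT.τ_mem) heq

omit [ContinuousSMul G M] in
theorem crossedHom_ext (hT : IsFalseTatePair p γ τ N H) {c c' : G → M} (hc : IsCrossedHom c)
    (hc' : IsCrossedHom c') (h : Continuous c) (h' : Continuous c')
    (hγ : c γ = c' γ) (hτ : c τ = c' τ) : c = c' := by
  have hs := hc.sub hc'
  have htop := hT.eq_top (hs.isClosed_zeros (h.sub h')) (by simp [IsCrossedHom.mem_zeros, hγ])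
    (by simp [IsCrossedHom.mem_zeros, hτ])
  funext g
  have hg : g ∈ hs.zeros := htop ▸ Subgroup.mem_top g
  exact sub_eq_zero.1 hg

variable [CompactSpace G] [FirstCountableTopology G] [Fact p.Prime]

theorem exists_crossedHom_N (hT : IsFalseTatePair p γ τ N H) (hM : IsPadicModule p M) (m : M) :
    ∃ c : N → M, Continuous c ∧ IsCrossedHom c ∧ c ⟨τ, hT.τ_mem⟩ = m :=
  exists_isCrossedHom_subgroup hM hT.closure_τ hT.padic_τ _ m

/-- Both `τ` and `γ τ γ⁻¹` topologically generate `N`, so evaluation at either identifies continuous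
crossed homomorphisms on `N` with `M`; `δ` compares the two. -/
theorem exists_normOp (hT : IsFalseTatePair p γ τ N H) (hM : IsPadicModule p M) :
    ∃ δ : M ≃+ M, ∀ c : N → M, Continuous c → IsCrossedHom c →
      δ (c ⟨τ, hT.τ_mem⟩) = c ⟨γ * τ * γ⁻¹, hT.conj_mem γ⟩ := by
  have := hT.normal
  have hcl := closure_zpowers_conj hT.closure_τ γ
  choose c hc hcc hcm using hT.exists_crossedHom_N hM
  choose c' hc' hcc' hcm' using
    exists_isCrossedHom_subgroup hM hcl (hT.padic_τ.conj γ) (hT.conj_mem γ)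
  have huniq : ∀ b : N → M, Continuous b → IsCrossedHom b → c (b ⟨τ, hT.τ_mem⟩) = b :=
    fun b hb hbc => hT.crossedHom_ext_N (hcc _) hbc (hc _) hb (hcm _)
  have huniq' : ∀ b : N → M, Continuous b → IsCrossedHom b →
      c' (b ⟨γ * τ * γ⁻¹, hT.conj_mem γ⟩) = b := fun b hb hbc =>
    (hcc' _).ext_of_dense hbc (hc' _) hb (denseRange_zpow_of_closure_eq hcl _) (hcm' _)
  refine ⟨{ toFun := fun m => c m ⟨γ * τ * γ⁻¹, hT.conj_mem γ⟩
            invFun := fun m => c' m ⟨τ, hT.τ_mem⟩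
            left_inv := fun m => ?_
            right_inv := fun m => ?_
            map_add' := fun a b => ?_ }, fun b hb hbc => ?_⟩
  · dsimp only
    rw [huniq' _ (hc m) (hcc m), hcm]
  · dsimp only
    rw [huniq _ (hc' m) (hcc' m), hcm']
  · have h := huniq _ ((hc a).add (hc b)) ((hcc a).add (hcc b))
    rw [Pi.add_apply, hcm, hcm] at h
    rw [h, Pi.add_apply]
  · change c _ _ = _
    rw [huniq b hb hbc]

/-- The operator `(τ ^ χ(γ) - 1) / (τ - 1)`: it sends the value at `τ` of a continuous crossed
homomorphism on `N` to its value at `γ τ γ⁻¹`. -/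
noncomputable def normOp (hT : IsFalseTatePair p γ τ N H) (hM : IsPadicModule p M) : M ≃+ M :=
  (hT.exists_normOp hM).choose

variable (hT : IsFalseTatePair p γ τ N H) (hM : IsPadicModule p M) (hM' : IsPadicModule p M')

include hT hM

theorem normOp_apply {c : N → M} (h : Continuous c) (hc : IsCrossedHom c) :
    hT.normOp hM (c ⟨τ, hT.τ_mem⟩) = c ⟨γ * τ * γ⁻¹, hT.conj_mem γ⟩ :=
  (hT.exists_normOp hM).choose_spec c h hc

/-- Apply the defining property of `δ` to the conjugate `n ↦ γ c(γ⁻¹ n γ)`: its values at `τ` and `γ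
τ γ⁻¹` are `γ c(γ⁻¹ τ γ)` and `γ c(τ)`. -/
theorem normOp_symm_smul {c : N → M} (h : Continuous c) (hc : IsCrossedHom c)
    (hm : γ⁻¹ * τ * γ ∈ N) :
    (hT.normOp hM).symm (γ • c ⟨τ, hT.τ_mem⟩) = γ • c ⟨γ⁻¹ * τ * γ, hm⟩ := by
  have := hT.normal
  rw [AddEquiv.symm_apply_eq]
  have h1 := hT.normOp_apply hM (c := fun n : N => γ • c (MulAut.conjNormal γ⁻¹ n))
    (by have := continuous_conjNormal (N := N) γ⁻¹; fun_prop) (hc.conj γ)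
  have h2 : MulAut.conjNormal γ⁻¹ (⟨τ, hT.τ_mem⟩ : N) = ⟨γ⁻¹ * τ * γ, hm⟩ :=
    Subtype.ext (by simp)
  have h3 : MulAut.conjNormal γ⁻¹ (⟨γ * τ * γ⁻¹, hT.conj_mem γ⟩ : N) = ⟨τ, hT.τ_mem⟩ :=
    Subtype.ext (by simp [mul_assoc])
  simp only [h2, h3] at h1
  exact h1.symm

include hM' in
-- An equivariant map carries crossed homomorphisms to crossed homomorphisms. This naturality is
-- what allows dimension shifting.
theorem map_normOp (φ : M →+ M') (hφ : Continuous φ) (hφG : ∀ (g : G) m, φ (g • m) = g • φ m)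
    (m : M) : φ (hT.normOp hM m) = hT.normOp hM' (φ m) := by
  obtain ⟨c, h, hc, rfl⟩ := hT.exists_crossedHom_N hM m
  rw [hT.normOp_apply hM h hc]
  exact (hT.normOp_apply hM' (hφ.comp h) (hc.comp_addMonoidHom φ fun n m => hφG n m)).symm

theorem map_gMap (φ : M →+ M') (hφ : Continuous φ) (hφG : ∀ (g : G) m, φ (g • m) = g • φ m)
    (x : M × M) : φ (FalseTate.gMap γ τ (hT.normOp hM) x) =
      FalseTate.gMap γ τ (hT.normOp hM') (φ x.1, φ x.2) := by
  have h : ∀ m, φ ((hT.normOp hM).symm m) = (hT.normOp hM').symm (φ m) := fun m => by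
    rw [AddEquiv.eq_symm_apply, ← hT.map_normOp hM hM' φ hφ hφG, AddEquiv.apply_symm_apply]
  simp [FalseTate.gMap, h, hφG]

/-- The value of `g_M` on a cochain that is a crossed homomorphism on `N`. -/
theorem gMap_eq {c : G → M} (h : Continuous c) (hc : IsCrossedHom fun n : N => c n) :
    FalseTate.gMap γ τ (hT.normOp hM) (c γ, c τ) =
      τ • c γ + c τ - (γ • c (γ⁻¹ * τ * γ) + c γ) := by
  have hm : γ⁻¹ * τ * γ ∈ N := by simpa using hT.conj_mem γ⁻¹
  have h1 := hT.normOp_symm_smul hM (h.comp continuous_subtype_val) hc hm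
  simp only [Function.comp_apply] at h1
  change (τ • c γ - c γ) + (c τ - (hT.normOp hM).symm (γ • c τ)) = _
  rw [h1]
  abel

/-- Expand `c` on the two factorisations `τ γ = γ (γ⁻¹ τ γ)`. -/
theorem gMap_eq_zero {c : G → M} (h : Continuous c) (hc : IsCrossedHom c) :
    FalseTate.gMap γ τ (hT.normOp hM) (c γ, c τ) = 0 := by
  rw [hT.gMap_eq hM h (hc.restrict N), sub_eq_zero]
  have h1 := hc τ γ
  have h2 := hc γ (γ⁻¹ * τ * γ)
  rw [show γ * (γ⁻¹ * τ * γ) = τ * γ by group, h1] at h2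
  rw [add_comm, h2, add_comm]

theorem gMap_comp_fMap :
    (FalseTate.gMap γ τ (hT.normOp hM)).comp (FalseTate.fMap M γ τ) = 0 := by
  ext m
  exact hT.gMap_eq_zero hM (c := fun g => g • m - m) (by fun_prop) (IsCrossedHom.coboundary m)

theorem isNormOperator {a : ℤ_[p]}
    (ha : ∀ s : ℕ → ℕ, Tendsto (fun n => (s n : ℤ_[p])) atTop (𝓝 a) →
      Tendsto (fun n => τ ^ s n) atTop (𝓝 (γ * τ * γ⁻¹))) :
    FalseTate.IsNormOperator p τ a (hT.normOp hM) := by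
  intro s _ hs m
  obtain ⟨c, h, hc, hcm⟩ := hT.exists_crossedHom_N hM m
  have h1 : Tendsto (fun n => (⟨τ, hT.τ_mem⟩ : N) ^ s n) atTop
      (𝓝 ⟨γ * τ * γ⁻¹, hT.conj_mem γ⟩) := by
    rw [tendsto_subtype_rng]
    simpa using ha s hs
  have h2 := (h.tendsto _).comp h1
  rw [← hT.normOp_apply hM h hc, hcm] at h2
  refine h2.congr fun n => ?_
  have h3 := hc.apply_zpow ⟨τ, hT.τ_mem⟩ (s n)
  rw [zpow_natCast, zpowSum_natCast, hcm] at h3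
  exact h3

/-- Take the crossed homomorphisms `a` on `N` and `b` on `H` with values `y` at `τ` and `x` at `γ`.
They glue if conjugating `a` by `h` adds the coboundary of `b h`, and density reduces this to `h =
γ`, `n = τ`, where it is the hypothesis. -/
theorem exists_crossedHom [T2Space G] {x y : M}
    (hxy : FalseTate.gMap γ τ (hT.normOp hM) (x, y) = 0) :
    ∃ c : G → M, Continuous c ∧ IsCrossedHom c ∧ c γ = x ∧ c τ = y := by
  have := hT.normal
  obtain ⟨a, ha, hac, hay⟩ := hT.exists_crossedHom_N hM y
  obtain ⟨b, hb, hbc, hbx⟩ := exists_isCrossedHom_subgroup hM hT.closure_γ hT.padic_γ hT.γ_mem x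
  have hconj : ∀ g : G, Continuous fun n : N => g • a (MulAut.conjNormal g⁻¹ n) := fun g => by
    have := continuous_conjNormal (N := N) g⁻¹
    fun_prop
  -- compatibility of the two crossed homomorphisms
  have key : ∀ (h : H) (n : N), (h : G) • a (MulAut.conjNormal (h : G)⁻¹ n) =
      a n + (n • b h - b h) := by
    let S : Subgroup H :=
      { carrier := {h | ∀ n : N, (h : G) • a (MulAut.conjNormal (h : G)⁻¹ n) =
          a n + (n • b h - b h)}
        one_mem' := fun n => by simp [hbc.map_one]
        mul_mem' := fun {h h'} hh hh' n => by
          have e1 : MulAut.conjNormal ((h * h' : H) : G)⁻¹ n =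
              MulAut.conjNormal (h' : G)⁻¹ (MulAut.conjNormal (h : G)⁻¹ n) := by
            rw [Subgroup.coe_mul, mul_inv_rev, map_mul, MulAut.mul_apply]
          have e2 : (h : G) • (MulAut.conjNormal (h : G)⁻¹ n • b h') = n • h • b h' := by
            simp only [Subgroup.smul_def, MulAut.conjNormal_apply, ← mul_smul]
            congr 1
            group
          have e3 : (h : G) • b h' = h • b h' := rfl
          rw [e1, Subgroup.coe_mul, mul_smul, hh', smul_add, hh, smul_sub, e2, e3, hbc, smul_add]
          abel
        inv_mem' := fun {h} hh n => by
          have e1 := hh (MulAut.conjNormal (h : G) n)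
          rw [← MulAut.mul_apply, ← map_mul, inv_mul_cancel, map_one, MulAut.one_apply] at e1
          have e2 : (h : G)⁻¹ • (MulAut.conjNormal (h : G) n • b h) = n • h⁻¹ • b h := by
            simp only [Subgroup.smul_def, MulAut.conjNormal_apply, ← mul_smul]
            congr 1
            simp [mul_assoc]
          have e3 : (h : G)⁻¹ • b h = h⁻¹ • b h := rfl
          have e4 := congrArg ((h : G)⁻¹ • ·) e1
          simp only [inv_smul_smul, smul_add, smul_sub, e2, e3] at e4
          rw [hbc.map_inv, Subgroup.coe_inv, inv_inv, smul_neg, e4]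
          abel }
    have hS : IsClosed (S : Set H) := by
      have : (S : Set H) = ⋂ n : N, {h : H | (h : G) • a (MulAut.conjNormal (h : G)⁻¹ n) =
          a n + (n • b h - b h)} := by
        ext h
        simp [S]
      rw [this]
      refine isClosed_iInter fun n => isClosed_eq ?_ (by fun_prop)
      refine Continuous.smul (by fun_prop) (ha.comp (Continuous.subtype_mk ?_ _))
      change Continuous fun h : H => (h : G)⁻¹ * n * (h : G)⁻¹⁻¹
      fun_prop
    -- Both sides are continuous crossed homomorphisms in `n`, so comparison at `τ` is enough.
    have hγS : (⟨γ, hT.γ_mem⟩ : H) ∈ S := by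
      intro n
      have e1 := hT.crossedHom_ext_N (hac.conj γ) (hac.add (IsCrossedHom.coboundary x))
        (hconj γ) (ha.add (by fun_prop)) ?_
      · rw [hbx]
        exact congrFun e1 n
      · have hm : γ⁻¹ * τ * γ ∈ N := by simpa using hT.conj_mem γ⁻¹
        have e2 := hT.normOp_symm_smul hM ha hac hm
        have e3 : MulAut.conjNormal γ⁻¹ (⟨τ, hT.τ_mem⟩ : N) = ⟨γ⁻¹ * τ * γ, hm⟩ :=
          Subtype.ext (by simp)
        rw [e3, ← e2, hay, Pi.add_apply, hay]
        change (τ • x - x) + (y - (hT.normOp hM).symm (γ • y)) = 0 at hxy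
        change _ = y + (τ • x - x)
        rw [← add_sub_assoc, sub_eq_zero] at hxy
        rw [← hxy, add_comm]
    intro h
    have hd := denseRange_zpow_of_closure_eq hT.closure_γ hT.γ_mem
    have : h ∈ (S : Set H) := by
      rw [← hS.closure_eq]
      refine closure_mono ?_ (hd h)
      rintro _ ⟨n, rfl⟩
      exact S.zpow_mem hγS n
    exact this
  obtain ⟨f, k, hf, hk, hfk, hfm, hkm⟩ := hT.exists_decomp
  -- The crossed homomorphism identity at `g = n h` forces this formula.
  refine ⟨fun g => a (f g) + f g • b (k g), by fun_prop, fun g g' => ?_, ?_, ?_⟩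
  · have e1 : g * g' = (f g * MulAut.conjNormal (k g : G) (f g') : N) * (k g * k g' : H) := by
      conv_lhs => rw [← hfk g, ← hfk g']
      simp [mul_assoc]
    have e2 := key (k g) (MulAut.conjNormal (k g : G) (f g'))
    rw [← MulAut.mul_apply, ← map_mul, inv_mul_cancel, map_one, MulAut.one_apply] at e2
    have e3 : g • (a (f g') + f g' • b (k g')) =
        f g • ((k g : G) • a (f g') + MulAut.conjNormal (k g : G) (f g') • k g • b (k g')) := by
      conv_lhs => rw [← hfk g]
      simp only [smul_add, Subgroup.smul_def, MulAut.conjNormal_apply, ← mul_smul]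
      congr 2
      simp [mul_assoc]
    have e4 : f (g * g') = f g * MulAut.conjNormal (k g : G) (f g') := by rw [e1, hfm]
    have e5 : k (g * g') = k g * k g' := by rw [e1, hkm]
    simp only [e3, e2, e4, e5, hac (f g), hbc (k g), mul_smul, smul_add, smul_sub]
    abel
  · have e1 : f γ = 1 := by simpa using hfm 1 ⟨γ, hT.γ_mem⟩
    have e2 : k γ = ⟨γ, hT.γ_mem⟩ := by simpa using hkm 1 ⟨γ, hT.γ_mem⟩
    simp [e1, e2, hbx, hac.map_one]
  · have e1 : f τ = ⟨τ, hT.τ_mem⟩ := by simpa using hfm ⟨τ, hT.τ_mem⟩ 1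
    have e2 : k τ = 1 := by simpa using hkm ⟨τ, hT.τ_mem⟩ 1
    simp [e1, e2, hay, hbc.map_one]

end IsFalseTatePair

/-! ### The coinduced module -/

/-- The coinduced module: continuous maps `G → M`, on which `G` acts by right translation. -/
def Coind (G : Type u) (M : Type v) [TopologicalSpace G] [TopologicalSpace M] : Type max u v :=
  C(G, M)

namespace Coind

variable {G : Type u} {M : Type v} [Group G] [TopologicalSpace G] [IsTopologicalGroup G]
  [AddCommGroup M] [TopologicalSpace M]

instance : TopologicalSpace (Coind G M) := inferInstanceAs (TopologicalSpace C(G, M))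

instance : FunLike (Coind G M) G M := inferInstanceAs (FunLike C(G, M) G M)

@[ext]
theorem ext {f f' : Coind G M} (h : ∀ x, f x = f' x) : f = f' := DFunLike.ext _ _ h

theorem continuous (f : Coind G M) : Continuous f := ContinuousMap.continuous f

/-- A continuous function as an element of the coinduced module. -/
def mk (f : G → M) (hf : Continuous f) : Coind G M := (⟨f, hf⟩ : C(G, M))

@[simp]
theorem mk_apply (f : G → M) (hf : Continuous f) (x : G) : mk f hf x = f x := rfl

instance [T2Space M] : T2Space (Coind G M) := inferInstanceAs (T2Space C(G, M))

theorem continuous_of_uncurry {X : Type*} [TopologicalSpace X] (F : X → Coind G M)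
    (h : Continuous fun x : X × G => F x.1 x.2) : Continuous F :=
  ContinuousMap.continuous_of_continuous_uncurry (X := X) (Y := G) (Z := M) F h

theorem continuous_eval_apply [LocallyCompactSpace G] :
    Continuous fun x : Coind G M × G => x.1 x.2 :=
  ContinuousEval.continuous_eval (F := C(G, M))

theorem continuous_apply (g : G) : Continuous fun f : Coind G M => f g :=
  ContinuousEvalConst.continuous_eval_const (F := C(G, M)) g

variable [IsTopologicalAddGroup M]

instance : AddCommGroup (Coind G M) := inferInstanceAs (AddCommGroup C(G, M))

@[simp]
theorem zero_apply (x : G) : (0 : Coind G M) x = 0 := rfl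

@[simp]
theorem add_apply (f f' : Coind G M) (x : G) : (f + f') x = f x + f' x := rfl

@[simp]
theorem neg_apply (f : Coind G M) (x : G) : (-f) x = -f x := rfl

@[simp]
theorem sub_apply (f f' : Coind G M) (x : G) : (f - f') x = f x - f' x := rfl

instance : IsTopologicalAddGroup (Coind G M) := inferInstanceAs (IsTopologicalAddGroup C(G, M))

/-- Evaluation at a point. -/
def eval (x : G) : Coind G M →+ M where
  toFun f := f x
  map_zero' := rfl
  map_add' _ _ := rfl

@[simp]
theorem eval_apply (x : G) (f : Coind G M) : eval x f = f x := rfl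

theorem mem_nhds_zero [CompactSpace G] {U : Set M} (hU : IsOpen U) (h0 : (0 : M) ∈ U) :
    {f : Coind G M | ∀ x, f x ∈ U} ∈ 𝓝 0 := by
  have h := ContinuousMap.isOpen_setOfPred_mapsTo (X := G) (Y := M) isCompact_univ hU
  refine mem_of_superset (h.mem_nhds (x := (0 : C(G, M))) fun x _ => h0) fun f hf x => ?_
  exact hf (Set.mem_univ x)

theorem exists_subset_of_mem_nhds_zero {W : Set (Coind G M)} (hW : W ∈ 𝓝 0) :
    ∃ U ∈ 𝓝 (0 : M), {f : Coind G M | ∀ x, f x ∈ U} ⊆ W := by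
  have hb := (𝓝 (0 : M)).basis_sets.nhds_continuousMapConst (X := G)
  obtain ⟨⟨K, U⟩, ⟨-, hU⟩, h⟩ := hb.mem_iff.1 hW
  exact ⟨U, hU, fun f hf => h fun x _ => hf x⟩

instance [DistribMulAction G M] : DistribMulAction G (Coind G M) where
  smul g f := mk (fun x => f (x * g)) (f.continuous.comp (by fun_prop))
  one_smul f := by
    ext x
    exact congrArg f (mul_one x)
  mul_smul g h f := by
    ext x
    exact congrArg f (mul_assoc x g h).symm
  smul_zero g := rfl
  smul_add g f f' := rfl

@[simp]
theorem smul_apply [DistribMulAction G M] (g : G) (f : Coind G M) (x : G) :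
    (g • f) x = f (x * g) := rfl

theorem nsmul_apply (n : ℕ) (f : Coind G M) (x : G) : (n • f) x = n • f x :=
  map_nsmul (eval x) n f

instance [DistribMulAction G M] [LocallyCompactSpace G] : ContinuousSMul G (Coind G M) where
  continuous_smul := by
    refine continuous_of_uncurry _ ?_
    exact continuous_eval_apply.comp
      (f := fun x : (G × Coind G M) × G => (x.1.2, x.2 * x.1.1)) (by fun_prop)

variable [DistribMulAction G M]

/-- The embedding `m ↦ (x ↦ x • m)` of `M` into the coinduced module. -/
def ι [ContinuousSMul G M] : M →+ Coind G M where
  toFun m := mk (fun x => x • m) (by fun_prop)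
  map_zero' := by
    ext x
    simp
  map_add' a b := by
    ext x
    simp

@[simp]
theorem ι_apply [ContinuousSMul G M] (m : M) (x : G) : ι m x = x • m := rfl

theorem ι_smul [ContinuousSMul G M] (g : G) (m : M) : ι (g • m) = g • (ι m : Coind G M) := by
  ext x
  simp [mul_smul]

theorem continuous_ι [ContinuousSMul G M] : Continuous (ι : M → Coind G M) := by
  refine continuous_of_uncurry _ ?_
  change Continuous fun x : M × G => x.2 • x.1
  fun_prop

theorem ι_injective [ContinuousSMul G M] : Function.Injective (ι : M → Coind G M) := fun a b h => by
  simpa using congrArg (eval (1 : G)) h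

end Coind

/-! ### Permanence of `p`-adic modules -/

section Padic

variable {A : Type*} [AddCommGroup A] [TopologicalSpace A] [NonarchimedeanAddGroup A]

instance (S : AddSubgroup A) : NonarchimedeanAddGroup S where
  is_nonarchimedean W hW := by
    obtain ⟨t, ht, htW⟩ := mem_nhds_induced (Subtype.val : S → A) 0 W |>.1 hW
    obtain ⟨V, hV⟩ := NonarchimedeanAddGroup.is_nonarchimedean t ht
    exact ⟨V.comap S.subtype continuous_subtype_val, fun x hx => htW (hV hx)⟩

theorem IsPadicModule.of_isClosed {p : ℕ} (hA : IsPadicModule p A) {S : AddSubgroup A}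
    (hS : IsClosed (S : Set A)) : IsPadicModule p S where
  tendsto_pow_nsmul m := by
    rw [tendsto_subtype_rng]
    simpa using hA.tendsto_pow_nsmul m
  cauchySeq_tendsto u hu := by
    obtain ⟨m, hm⟩ := hA.cauchySeq_tendsto (fun n => (u n : A)) fun U hU => by
      obtain ⟨N, hN⟩ := hu (Subtype.val ⁻¹' U)
        (continuous_subtype_val.continuousAt.preimage_mem_nhds (by simpa using hU))
      exact ⟨N, fun i hi j hj => by simpa using hN i hi j hj⟩
    have hmS : m ∈ S := hS.mem_of_tendsto hm (Eventually.of_forall fun n => (u n).2)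
    exact ⟨⟨m, hmS⟩, tendsto_subtype_rng.2 hm⟩

end Padic

namespace Coind

variable {G : Type u} {M : Type v} [Group G] [TopologicalSpace G] [IsTopologicalGroup G]
  [CompactSpace G] [AddCommGroup M] [TopologicalSpace M] [NonarchimedeanAddGroup M]

instance : NonarchimedeanAddGroup (Coind G M) where
  is_nonarchimedean W hW := by
    obtain ⟨U, hU, hUW⟩ := exists_subset_of_mem_nhds_zero hW
    obtain ⟨V, hV⟩ := NonarchimedeanAddGroup.is_nonarchimedean U hU
    let T : AddSubgroup (Coind G M) :=
      { carrier := {f | ∀ x, f x ∈ V}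
        add_mem' := fun hf hf' x => V.add_mem (hf x) (hf' x)
        zero_mem' := fun x => V.zero_mem
        neg_mem' := fun hf x => V.neg_mem (hf x) }
    have hT : IsOpen (T : Set (Coind G M)) :=
      AddSubgroup.isOpen_of_mem_nhds T (g := 0) (mem_nhds_zero V.isOpen V.zero_mem)
    exact ⟨⟨T, hT⟩, fun f hf => hUW fun x => hV (hf x)⟩

/-- The topology is that of uniform convergence. For fixed `f`, the sets where `p ^ n • f x ∈ V` are
open and increase to `G`, so compactness makes `p ^ n • f → 0` uniform; a Cauchy sequence has a
uniform, hence continuous, limit. -/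
theorem isPadicModule {p : ℕ} (hM : IsPadicModule p M) : IsPadicModule p (Coind G M) where
  tendsto_pow_nsmul f := by
    intro W hW
    obtain ⟨U, hU, hUW⟩ := exists_subset_of_mem_nhds_zero hW
    obtain ⟨V, hV⟩ := NonarchimedeanAddGroup.is_nonarchimedean U hU
    have hmono : ∀ i j : ℕ, i ≤ j → ∀ x, p ^ i • f x ∈ V → p ^ j • f x ∈ V := by
      intro i j hij x hx
      obtain ⟨k, rfl⟩ := Nat.exists_eq_add_of_le hij
      rw [pow_add, mul_comm, mul_smul]
      exact V.toAddSubgroup.nsmul_mem hx _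
    obtain ⟨n, hn⟩ := isCompact_univ.elim_directed_cover (fun n : ℕ => {x | p ^ n • f x ∈ V})
      (fun n => V.isOpen.preimage (f.continuous.const_smul (p ^ n)))
      (fun x _ => Set.mem_iUnion.2
        ((hM.tendsto_pow_nsmul (f x)).eventually (V.isOpen.mem_nhds V.zero_mem)).exists)
      (directed_of_isDirected_le fun i j hij x hx => hmono i j hij x hx)
    change ∀ᶠ k in atTop, _ ∈ W
    filter_upwards [eventually_ge_atTop n] with k hk
    refine hUW fun x => hV ?_
    rw [nsmul_apply]
    exact hmono n k hk x (hn (Set.mem_univ x))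
  cauchySeq_tendsto u hu := by
    have hpt : ∀ x, ∃ m, Tendsto (fun n => u n x) atTop (𝓝 m) := fun x =>
      hM.cauchySeq_tendsto _ fun U hU => by
        obtain ⟨N, hN⟩ := hu {f | f x ∈ U} ((continuous_apply x).continuousAt.preimage_mem_nhds hU)
        exact ⟨N, fun i hi j hj => hN i hi j hj⟩
    choose g hg using hpt
    have hunif : ∀ V : OpenAddSubgroup M, ∃ N, ∀ i ≥ N, ∀ x, u i x - g x ∈ V := by
      intro V
      obtain ⟨N, hN⟩ := hu _ (mem_nhds_zero V.isOpen V.zero_mem)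
      refine ⟨N, fun i hi x => V.isClosed.mem_of_tendsto ((hg x).const_sub (u i x)) ?_⟩
      filter_upwards [eventually_ge_atTop N] with j hj
      exact hN i hi j hj x
    have hgc : Continuous g := by
      refine continuous_iff_continuousAt.2 fun x => ?_
      rw [ContinuousAt, ← tendsto_sub_nhds_zero_iff]
      intro W hW
      obtain ⟨V, hV⟩ := NonarchimedeanAddGroup.is_nonarchimedean W hW
      obtain ⟨N, hN⟩ := hunif V
      have h1 := tendsto_sub_nhds_zero_iff.2 ((u N).continuous.tendsto x)
      change ∀ᶠ y in 𝓝 x, _ ∈ W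
      filter_upwards [h1.eventually (V.isOpen.mem_nhds V.zero_mem)] with y hy
      refine hV ?_
      have h2 := V.add_mem (V.sub_mem hy (hN N le_rfl y)) (hN N le_rfl x)
      rwa [show u N y - u N x - (u N y - g y) + (u N x - g x) = g y - g x by abel] at h2
    refine ⟨mk g hgc, ?_⟩
    rw [← tendsto_sub_nhds_zero_iff]
    intro W hW
    obtain ⟨U, hU, hUW⟩ := exists_subset_of_mem_nhds_zero hW
    obtain ⟨V, hV⟩ := NonarchimedeanAddGroup.is_nonarchimedean U hU
    obtain ⟨N, hN⟩ := hunif V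
    change ∀ᶠ k in atTop, _ ∈ W
    filter_upwards [eventually_ge_atTop N] with k hk
    exact hUW fun x => hV (hN k hk x)

end Coind

/-! ### The dimension-shifting quotient -/

/-- The quotient of the coinduced module by `M`, realised as the maps that vanish at `1`. -/
def Shift (G : Type u) (M : Type v) [Group G] [TopologicalSpace G] [AddCommGroup M]
    [TopologicalSpace M] [IsTopologicalAddGroup M] : Type max u v :=
  (Coind.eval (M := M) (1 : G)).ker

namespace Shift

variable {G : Type u} {M : Type v} [Group G] [TopologicalSpace G] [IsTopologicalGroup G]
  [AddCommGroup M] [TopologicalSpace M]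

section

variable [IsTopologicalAddGroup M]

instance : AddCommGroup (Shift G M) :=
  inferInstanceAs (AddCommGroup (Coind.eval (M := M) (1 : G)).ker)

instance : TopologicalSpace (Shift G M) :=
  inferInstanceAs (TopologicalSpace (Coind.eval (M := M) (1 : G)).ker)

instance [T2Space M] : T2Space (Shift G M) :=
  inferInstanceAs (T2Space (Coind.eval (M := M) (1 : G)).ker)

/-- The inclusion into the coinduced module. -/
def incl : Shift G M →+ Coind G M := (Coind.eval (M := M) (1 : G)).ker.subtype

theorem incl_injective : Function.Injective (incl : Shift G M → Coind G M) :=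
  Subtype.val_injective

theorem continuous_incl : Continuous (incl : Shift G M → Coind G M) := continuous_subtype_val

@[simp]
theorem incl_apply_one (f : Shift G M) : incl f 1 = 0 := f.2

variable [DistribMulAction G M] [ContinuousSMul G M]

/-- The projection from the coinduced module. -/
def pr : Coind G M →+ Shift G M :=
  ((AddMonoidHom.id _) - Coind.ι.comp (Coind.eval (1 : G))).codRestrict _ fun f => by
    simp [AddMonoidHom.mem_ker]

@[simp]
theorem incl_pr (f : Coind G M) : incl (pr f) = f - Coind.ι (f 1) := rfl

theorem continuous_pr : Continuous (pr : Coind G M → Shift G M) :=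
  Continuous.subtype_mk
    (continuous_id.sub (Coind.continuous_ι.comp (Coind.continuous_apply (1 : G)))) _

@[simp]
theorem pr_incl (f : Shift G M) : pr (incl f) = f := incl_injective (by simp)

@[simp]
theorem pr_ι (m : M) : pr (Coind.ι m : Coind G M) = 0 := incl_injective (by simp)

theorem pr_eq_zero_iff {f : Coind G M} : pr f = 0 ↔ f = Coind.ι (f 1) := by
  rw [← incl_injective.eq_iff, incl_pr, map_zero, sub_eq_zero]

/-- Translation does not preserve vanishing at `1`, so the quotient action is transported through
`pr`. Thus `pr` is equivariant, while `incl` serves only as a continuous additive section of it. -/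
instance : DistribMulAction G (Shift G M) where
  smul g f := pr (g • incl f)
  one_smul f := by
    change pr ((1 : G) • incl f) = f
    simp
  mul_smul g h f := by
    change pr ((g * h) • incl f) = pr (g • incl (pr (h • incl f)))
    rw [incl_pr, smul_sub, map_sub, ← Coind.ι_smul, pr_ι, sub_zero, mul_smul]
  smul_zero g := by
    change pr (g • incl 0) = 0
    simp
  smul_add g f f' := by
    change pr (g • incl (f + f')) = pr (g • incl f) + pr (g • incl f')
    simp

theorem smul_def (g : G) (f : Shift G M) : g • f = pr (g • incl f) := rfl

theorem pr_smul (g : G) (f : Coind G M) : pr (g • f) = g • pr f := by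
  rw [smul_def, incl_pr, smul_sub, map_sub, ← Coind.ι_smul, pr_ι, sub_zero]

instance [LocallyCompactSpace G] : ContinuousSMul G (Shift G M) where
  continuous_smul := by
    have h := continuous_incl (G := G) (M := M)
    exact continuous_pr.comp (f := fun x : G × Shift G M => x.1 • incl x.2) (by fun_prop)

end

variable [NonarchimedeanAddGroup M] [CompactSpace G]

instance : NonarchimedeanAddGroup (Shift G M) :=
  inferInstanceAs (NonarchimedeanAddGroup (Coind.eval (M := M) (1 : G)).ker)

theorem isPadicModule [T2Space M] {p : ℕ} (hM : IsPadicModule p M) :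
    IsPadicModule p (Shift G M) :=
  (Coind.isPadicModule hM).of_isClosed (S := (Coind.eval (M := M) (1 : G)).ker)
    (isClosed_eq (Coind.continuous_apply 1) continuous_const)

end Shift

namespace IsFalseTatePair

variable {G : Type u} [Group G] [TopologicalSpace G] [IsTopologicalGroup G] [CompactSpace G]
  [T2Space G] [FirstCountableTopology G] {p : ℕ} [Fact p.Prime] {γ τ : G} {N H : Subgroup G}
  {M : Type v} [AddCommGroup M] [TopologicalSpace M] [NonarchimedeanAddGroup M] [T2Space M]
  [DistribMulAction G M] [ContinuousSMul G M]

/-- Let `c : N → C(G, M)` be the crossed homomorphism with `c(τ) = f`, and put `φ(h n) = c(n)(h)`.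
Then `φ(h n τ) - φ(h n) = (n • f)(h) = f(h n)`. -/
theorem exists_smul_sub_eq_coind (hT : IsFalseTatePair p γ τ N H) (hM : IsPadicModule p M)
    (f : Coind G M) : ∃ φ : Coind G M, τ • φ - φ = f := by
  obtain ⟨c, h, hc, hcτ⟩ := hT.exists_crossedHom_N (Coind.isPadicModule hM) f
  obtain ⟨a, k, ha, hk, hak, ham, hkm⟩ := hT.exists_decomp
  -- The decomposition available is `N H`; the order `x = h n` needed here comes from decomposing
  -- `x⁻¹` and inverting.
  have hφ : Continuous fun x : G => c (a x⁻¹)⁻¹ ((k x⁻¹)⁻¹ : H) :=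
    Coind.continuous_eval_apply.comp
      (f := fun x : G => (c (a x⁻¹)⁻¹, (((k x⁻¹)⁻¹ : H) : G))) (by fun_prop)
  refine ⟨Coind.mk _ hφ, Coind.ext fun x => ?_⟩
  rw [Coind.sub_apply, Coind.smul_apply, Coind.mk_apply, Coind.mk_apply]
  have e1 : (x * τ)⁻¹ = ((⟨τ, hT.τ_mem⟩⁻¹ * a x⁻¹ : N) : G) * (k x⁻¹ : H) := by
    simp [mul_assoc, hak]
  have e2 : x = ((k x⁻¹)⁻¹ : H) * ((a x⁻¹)⁻¹ : N) := by
    have := congrArg (·⁻¹) (hak x⁻¹)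
    simpa using this.symm
  rw [e1, ham, hkm, mul_inv_rev, inv_inv, hc, Coind.add_apply, add_sub_cancel_left, hcτ,
    Subgroup.smul_def, Coind.smul_apply]
  rw [← e2]

theorem exists_smul_sub_eq_shift (hT : IsFalseTatePair p γ τ N H) (hM : IsPadicModule p M)
    (f : Shift G M) : ∃ φ : Shift G M, τ • φ - φ = f := by
  obtain ⟨φ, hφ⟩ := hT.exists_smul_sub_eq_coind hM (Shift.incl f)
  exact ⟨Shift.pr φ, by rw [← Shift.pr_smul, ← map_sub, hφ, Shift.pr_incl]⟩

end IsFalseTatePair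

/-! ### Cochains and dimension shifting -/

namespace ContCohomology

section Differential

variable {G M M' : Type*} [Group G] [AddCommGroup M] [DistribMulAction G M]
  [AddCommGroup M'] [DistribMulAction G M']

theorem dFun_zero_apply (f : (Fin 0 → G) → M) (g : Fin 1 → G) :
    dFun 0 f g = g 0 • f ![] - f ![] := by
  simp [dFun, sub_eq_add_neg, Subsingleton.elim _ (![] : Fin 0 → G)]

theorem dFun_one_apply (F : G → M) (g : Fin 2 → G) :
    dFun 1 (fun v => F (v 0)) g = g 0 • F (g 1) - F (g 0 * g 1) + F (g 0) := by
  simp [dFun, Fin.sum_univ_succ, Fin.contractNth, sub_eq_add_neg, add_assoc]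

theorem dFun_comp_map (φ : M →+ M') (hφ : ∀ (g : G) m, φ (g • m) = g • φ m) (n : ℕ)
    (f : (Fin n → G) → M) (g : Fin (n + 1) → G) :
    dFun n (fun x => φ (f x)) g = φ (dFun n f g) := by
  simp [dFun, hφ]

theorem contractNth_zero_cons (n : ℕ) (x : G) (g : Fin (n + 1) → G) :
    Fin.contractNth 0 (· * ·) (Fin.cons x g : Fin (n + 2) → G) =
      Fin.cons (x * g 0) fun i => g i.succ := by
  funext k
  refine Fin.cases ?_ (fun i => ?_) k
  · simp [Fin.contractNth]
  · simp [Fin.contractNth]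

theorem contractNth_succ_cons (n : ℕ) (j : Fin (n + 1)) (x : G) (g : Fin (n + 1) → G) :
    Fin.contractNth j.succ (· * ·) (Fin.cons x g : Fin (n + 2) → G) =
      Fin.cons x (Fin.contractNth j (· * ·) g) := by
  funext k
  refine Fin.cases ?_ (fun i => ?_) k
  · simp [Fin.contractNth]
  · simp [Fin.contractNth]

/-- With the first variable `x` split off, the bracket is the differential of the curried cochain `g
↦ (x ↦ c(x, g))`: the term with `x * g 0` is right translation by `g 0`. -/
theorem dFun_cons (n : ℕ) (c : (Fin (n + 1) → G) → M) (x : G) (g : Fin (n + 1) → G) :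
    dFun (n + 1) c (Fin.cons x g) = x • c g -
      (c (Fin.cons (x * g 0) fun i => g i.succ) +
        ∑ j : Fin (n + 1), (-1 : ℤ) ^ ((j : ℕ) + 1) •
          c (Fin.cons x (Fin.contractNth j (· * ·) g))) := by
  rw [dFun, Fin.sum_univ_succ]
  simp only [contractNth_zero_cons, contractNth_succ_cons, Fin.cons_zero, Fin.cons_succ,
    Fin.val_zero, Fin.val_succ, pow_succ, pow_zero, mul_neg, mul_one, neg_neg, neg_smul,
    one_smul, Finset.sum_neg_distrib]
  abel

end Differential

section Cochains

variable {G : Type u} [Group G] [TopologicalSpace G] [IsTopologicalGroup G]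
  {M : Type v} [AddCommGroup M] [TopologicalSpace M] [IsTopologicalAddGroup M]
  [DistribMulAction G M] [ContinuousSMul G M]
  {M' : Type w} [AddCommGroup M'] [TopologicalSpace M'] [IsTopologicalAddGroup M']
  [DistribMulAction G M'] [ContinuousSMul G M']

theorem d_apply (n : ℕ) (f : Cochain G M n) (g : Fin (n + 1) → G) :
    d G M n f g = dFun n f g := rfl

theorem mem_cocycles_iff {n : ℕ} {f : Cochain G M n} : f ∈ cocycles G M n ↔ d G M n f = 0 :=
  Iff.rfl

/-- Composition of a cochain with a continuous homomorphism. -/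
def mapCochain (φ : M →+ M') (hφ : Continuous φ) {n : ℕ} (f : Cochain G M n) : Cochain G M' n :=
  ⟨fun g => φ (f g), hφ.comp f.continuous⟩

theorem d_mapCochain (φ : M →+ M') (hφ : Continuous φ) (hφG : ∀ (g : G) m, φ (g • m) = g • φ m)
    {n : ℕ} (f : Cochain G M n) :
    d G M' n (mapCochain φ hφ f) = mapCochain φ hφ (d G M n f) := by
  ext g
  exact dFun_comp_map φ hφG n f g

/-- A continuous function on `G` as a `1`-cochain. -/
def cochainOne (F : G → M) (hF : Continuous F) : Cochain G M 1 :=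
  ⟨fun v => F (v 0), by fun_prop⟩

theorem cochainOne_apply (F : G → M) (hF : Continuous F) (v : Fin 1 → G) :
    cochainOne F hF v = F (v 0) := rfl

theorem eq_cochainOne (f : Cochain G M 1) :
    f = cochainOne (fun g => f ![g]) (by fun_prop) := by
  ext v
  rw [cochainOne_apply]
  congr 1
  funext i
  rw [Subsingleton.elim i 0]
  rfl

theorem d_cochainOne (F : G → M) (hF : Continuous F) (g : Fin 2 → G) :
    d G M 1 (cochainOne F hF) g = g 0 • F (g 1) - F (g 0 * g 1) + F (g 0) :=
  dFun_one_apply F g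

theorem cochainOne_mem_cocycles_iff {F : G → M} {hF : Continuous F} :
    cochainOne F hF ∈ cocycles G M 1 ↔ IsCrossedHom F := by
  rw [mem_cocycles_iff]
  refine ⟨fun h a b => ?_, fun h => ?_⟩
  · have h1 := DFunLike.congr_fun h ![a, b]
    rw [d_cochainOne] at h1
    change a • F b - F (a * b) + F a = 0 at h1
    rw [sub_add_eq_add_sub, sub_eq_zero] at h1
    rw [← h1, add_comm]
  · ext g
    rw [d_cochainOne, h]
    simp

theorem isCrossedHom_of_mem_cocycles {f : Cochain G M 1} (hf : f ∈ cocycles G M 1) :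
    IsCrossedHom fun g => f ![g] := by
  rw [eq_cochainOne f, cochainOne_mem_cocycles_iff] at hf
  exact hf

theorem exists_equiv_of_surjective {A : Type*} [AddCommGroup A] {n : ℕ}
    (φ : cocycles G M n →+ A) (hφ : Function.Surjective φ)
    (hker : ∀ c : cocycles G M n, φ c = 0 ↔ c.1 ∈ coboundaries G M n) :
    ∃ e : H G M n ≃+ A, ∀ c, e (cls c) = φ c := by
  have h : (coboundaries G M n).addSubgroupOf (cocycles G M n) = φ.ker := by
    ext c
    rw [AddSubgroup.mem_addSubgroupOf, AddMonoidHom.mem_ker, hker]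
  exact ⟨(QuotientAddGroup.quotientAddEquivOfEq h).trans
    (QuotientAddGroup.quotientKerEquivOfSurjective φ hφ), fun c => rfl⟩

theorem cls_eq_cls_iff {n : ℕ} {c c' : cocycles G M n} :
    cls c = cls c' ↔ c'.1 - c.1 ∈ coboundaries G M n := by
  rw [cls, cls, QuotientAddGroup.eq, AddSubgroup.mem_addSubgroupOf, neg_add_eq_sub]
  rfl

theorem subsingleton_H_iff {n : ℕ} :
    Subsingleton (H G M n) ↔ cocycles G M n ≤ coboundaries G M n := by
  rw [QuotientAddGroup.subsingleton_iff, AddSubgroup.addSubgroupOf_eq_top]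

variable [CompactSpace G]

/-- The `n`-cochain with values in the coinduced module attached to an `n + 1`-cochain. -/
def curryCochain {n : ℕ} (c : Cochain G M (n + 1)) : Cochain G (Coind G M) n where
  toFun g := Coind.mk (fun x => c (Fin.cons x g)) (by fun_prop)
  continuous_toFun := by
    refine Coind.continuous_of_uncurry _ ?_
    simp only [Coind.mk_apply]
    fun_prop

/-- Evaluation of a cochain with values in the coinduced module at `1`. -/
def evalOne {n : ℕ} (F : Cochain G (Coind G M) n) : Cochain G M n :=
  ⟨fun g => F g 1, (Coind.continuous_apply 1).comp F.continuous⟩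

end Cochains

section

variable {G : Type u} [Group G] [TopologicalSpace G] [IsTopologicalGroup G] [CompactSpace G]
  {M : Type v} [AddCommGroup M] [TopologicalSpace M] [NonarchimedeanAddGroup M]
  [DistribMulAction G M] [ContinuousSMul G M]

/-- This is the cocycle identity of `c` at `(x, g)`. It exhibits every cocycle of positive degree as
a coboundary after coinduction. -/
theorem d_curryCochain {n : ℕ} {c : Cochain G M (n + 1)} (hc : c ∈ cocycles G M (n + 1)) :
    d G (Coind G M) n (curryCochain c) = mapCochain Coind.ι Coind.continuous_ι c := by
  ext g x
  have h1 := DFunLike.congr_fun (mem_cocycles_iff.1 hc) (Fin.cons x g)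
  rw [d_apply, dFun_cons, ContinuousMap.zero_apply, sub_eq_zero] at h1
  change Coind.eval x (dFun n (curryCochain c) g) = x • c g
  rw [h1, dFun, map_add, map_sum]
  simp only [map_zsmul]
  rfl

theorem cochain_eq_mapι {n : ℕ} {F : Cochain G (Coind G M) n}
    (h : mapCochain Shift.pr Shift.continuous_pr F = 0) :
    F = mapCochain Coind.ι Coind.continuous_ι (evalOne F) := by
  ext g : 1
  exact Shift.pr_eq_zero_iff.1 (DFunLike.congr_fun h g)

theorem mapι_injective {n : ℕ} {f f' : Cochain G M n}
    (h : mapCochain (Coind.ι : M →+ Coind G M) Coind.continuous_ι f =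
      mapCochain Coind.ι Coind.continuous_ι f') : f = f' := by
  ext g
  exact Coind.ι_injective (DFunLike.congr_fun h g)

theorem mapCochain_sub {M' : Type w} [AddCommGroup M'] [TopologicalSpace M']
    [IsTopologicalAddGroup M'] (φ : M →+ M') (hφ : Continuous φ) {n : ℕ}
    (f f' : Cochain G M n) : mapCochain φ hφ (f - f') = mapCochain φ hφ f - mapCochain φ hφ f' := by
  ext g
  exact map_sub φ _ _

/-- The curried cocycle is a cocycle modulo `M`, hence bounds some `E` there. Subtracting the
boundary of the section applied to `E` leaves an `M`-valued cochain, still with boundary `c`. -/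
theorem subsingleton_H_of_shift {n : ℕ} (h : Subsingleton (H G (Shift G M) (n + 1))) :
    Subsingleton (H G M (n + 2)) := by
  rw [subsingleton_H_iff] at h ⊢
  intro c hc
  have hF := d_curryCochain hc
  have hprι : ∀ {k : ℕ} (f : Cochain G M k), mapCochain Shift.pr Shift.continuous_pr
      (mapCochain (Coind.ι : M →+ Coind G M) Coind.continuous_ι f) = 0 := fun f => by
    ext g : 1
    exact Shift.pr_ι _
  have h1 : mapCochain Shift.pr Shift.continuous_pr (curryCochain c) ∈
      cocycles G (Shift G M) (n + 1) := by
    rw [mem_cocycles_iff, d_mapCochain _ _ Shift.pr_smul, hF, hprι]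
  obtain ⟨E, hE⟩ := h h1
  set E' := mapCochain Shift.incl Shift.continuous_incl E
  have hE' : mapCochain Shift.pr Shift.continuous_pr E' = E := by
    ext g : 1
    exact Shift.pr_incl _
  have h2 : mapCochain Shift.pr Shift.continuous_pr (curryCochain c - d G (Coind G M) n E') = 0 := by
    rw [mapCochain_sub, ← d_mapCochain _ _ Shift.pr_smul, hE', hE, sub_self]
  refine ⟨evalOne (curryCochain c - d G (Coind G M) n E'), mapι_injective ?_⟩
  rw [← d_mapCochain _ _ Coind.ι_smul, ← cochain_eq_mapι h2, map_sub, d_d, sub_zero, hF]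

end

end ContCohomology

/-! ### Lifts of `2`-cocycles to the coinduced module -/

namespace ContCohomology

variable {G : Type u} [Group G] [TopologicalSpace G] [IsTopologicalGroup G] [CompactSpace G]
  {M : Type v} [AddCommGroup M] [TopologicalSpace M] [NonarchimedeanAddGroup M]
  [DistribMulAction G M] [ContinuousSMul G M]

theorem cochain_two_apply (c : Cochain G M 2) (g : Fin 2 → G) : c g = c ![g 0, g 1] := by
  congr 1
  funext i
  fin_cases i <;> rfl

/-- `F` is a cochain with values in the coinduced module that bounds the image of `c`. -/
structure IsLift (c : Cochain G M 2) (F : G → Coind G M) : Prop where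
  continuous : Continuous F
  eq : ∀ a b, a • F b - F (a * b) + F a = Coind.ι (c ![a, b])

theorem IsLift.sub {c : Cochain G M 2} {F F' : G → Coind G M} (h : IsLift c F)
    (h' : IsLift c F') : IsCrossedHom (F - F') := fun a b => by
  have e := (h.eq a b).trans (h'.eq a b).symm
  simp only [Pi.sub_apply, smul_sub]
  rw [← sub_eq_zero] at e ⊢
  rw [← neg_eq_zero, ← e]
  abel

theorem IsLift.sub_isCrossedHom {c : Cochain G M 2} {F f : G → Coind G M} (h : IsLift c F)
    (hf : Continuous f) (hfc : IsCrossedHom f) : IsLift c (F - f) where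
  continuous := h.continuous.sub hf
  eq a b := by
    rw [← h.eq a b]
    simp only [Pi.sub_apply, smul_sub, hfc a b]
    abel

theorem IsLift.pr {c : Cochain G M 2} {F : G → Coind G M} (h : IsLift c F) :
    IsCrossedHom (Shift.pr ∘ F) := fun a b => by
  have e := congrArg Shift.pr (h.eq a b)
  rw [Shift.pr_ι, map_add, map_sub, Shift.pr_smul, sub_add_eq_add_sub, sub_eq_zero] at e
  simp only [Function.comp_apply]
  rw [← e, add_comm]

theorem isLift_curry {c : Cochain G M 2} (hc : c ∈ cocycles G M 2) :
    IsLift c fun g => curryCochain c ![g] where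
  continuous := by fun_prop
  eq a b := by
    have h := DFunLike.congr_fun (d_curryCochain hc) ![a, b]
    rw [eq_cochainOne (curryCochain c), d_cochainOne] at h
    exact h

theorem IsLift.mem_cocycles {c : Cochain G M 2} {F : G → Coind G M} (h : IsLift c F) :
    c ∈ cocycles G M 2 := by
  rw [mem_cocycles_iff]
  apply mapι_injective
  have h1 : d G (Coind G M) 1 (cochainOne F h.continuous) =
      mapCochain Coind.ι Coind.continuous_ι c := by
    ext g : 1
    rw [d_cochainOne, h.eq, ← cochain_two_apply]
    rfl
  rw [← d_mapCochain _ _ Coind.ι_smul, ← h1, d_d]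
  ext g : 1
  exact (map_zero Coind.ι).symm

theorem isLift_d {b : G → M} (hb : Continuous b) :
    IsLift (d G M 1 (cochainOne b hb)) fun g => Coind.ι (b g) where
  continuous := Coind.continuous_ι.comp hb
  eq x y := by
    rw [d_cochainOne, map_add, map_sub, ← Coind.ι_smul]
    rfl

/-- A lift with values in `M` already bounds `c` over `M`, by injectivity of `ι`. -/
theorem IsLift.eq_d {c : Cochain G M 2} {F : G → Coind G M} (h : IsLift c F) {b : G → M}
    (hb : Continuous b) (hFb : ∀ g, F g = Coind.ι (b g)) : c = d G M 1 (cochainOne b hb) := by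
  ext g
  apply Coind.ι_injective (G := G)
  rw [cochain_two_apply, ← h.eq, d_cochainOne, map_add, map_sub, Coind.ι_smul, hFb, hFb, hFb]

end ContCohomology

/-! ### Cohomology in each degree -/

open ContCohomology FalseTate

namespace IsFalseTatePair

variable {G : Type u} [Group G] [TopologicalSpace G] [IsTopologicalGroup G] [CompactSpace G]
  [T2Space G] [FirstCountableTopology G] {p : ℕ} [Fact p.Prime] {γ τ : G} {N K : Subgroup G}
  {M : Type v} [AddCommGroup M] [TopologicalSpace M] [NonarchimedeanAddGroup M] [T2Space M]
  [DistribMulAction G M] [ContinuousSMul G M]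
  (hT : IsFalseTatePair p γ τ N K) (hM : IsPadicModule p M)

include hT

theorem exists_equiv_zero : ∃ e₀ : H G M 0 ≃+ (fMap M γ τ).ker,
    ∀ c : cocycles G M 0, (e₀ (cls c) : M) = c.1 ![] := by
  have hmem : ∀ c : cocycles G M 0, ∀ g : G, g • c.1 ![] = c.1 ![] := fun c g => by
    have h := DFunLike.congr_fun (mem_cocycles_iff.1 c.2) ![g]
    rw [d_apply, dFun_zero_apply] at h
    exact sub_eq_zero.1 h
  let φ : cocycles G M 0 →+ (fMap M γ τ).ker :=
    { toFun := fun c => ⟨c.1 ![], by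
        rw [AddMonoidHom.mem_ker]
        exact Prod.ext (sub_eq_zero.2 (hmem c γ)) (sub_eq_zero.2 (hmem c τ))⟩
      map_zero' := rfl
      map_add' := fun _ _ => rfl }
  suffices h : Function.Surjective φ ∧ ∀ c, φ c = 0 ↔ c.1 ∈ coboundaries G M 0 by
    obtain ⟨e, he⟩ := exists_equiv_of_surjective φ h.1 h.2
    exact ⟨e, fun c => congrArg Subtype.val (he c)⟩
  refine ⟨fun m => ?_, fun c => ?_⟩
  · have h := AddMonoidHom.mem_ker.1 m.2
    have h0 := hT.crossedHom_ext (IsCrossedHom.coboundary (m : M))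
      (IsCrossedHom.coboundary (0 : M)) (by fun_prop) (by fun_prop)
      (by simpa [fMap] using congrArg Prod.fst h) (by simpa [fMap] using congrArg Prod.snd h)
    refine ⟨⟨⟨fun _ => m, continuous_const⟩, ?_⟩, rfl⟩
    rw [mem_cocycles_iff]
    ext g
    rw [d_apply, dFun_zero_apply]
    simpa using congrFun h0 (g 0)
  · change _ ↔ c.1 ∈ (⊥ : AddSubgroup _)
    rw [AddSubgroup.mem_bot, Subtype.ext_iff]
    change c.1 ![] = 0 ↔ _
    refine ⟨fun h => ?_, fun h => by rw [h]; rfl⟩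
    ext g
    rw [Subsingleton.elim g ![]]
    exact h

include hM

theorem exists_equiv_one : ∃ e₁ : H G M 1 ≃+ (gMap γ τ (hT.normOp hM)).ker ⧸
      (fMap M γ τ).range.addSubgroupOf (gMap γ τ (hT.normOp hM)).ker,
    ∀ c : cocycles G M 1, ∃ h : (c.1 ![γ], c.1 ![τ]) ∈ (gMap γ τ (hT.normOp hM)).ker,
      e₁ (cls c) = QuotientAddGroup.mk ⟨(c.1 ![γ], c.1 ![τ]), h⟩ := by
  have hmem : ∀ c : cocycles G M 1,
      (c.1 ![γ], c.1 ![τ]) ∈ (gMap γ τ (hT.normOp hM)).ker := fun c =>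
    hT.gMap_eq_zero hM (c := fun g => c.1 ![g]) (by fun_prop) (isCrossedHom_of_mem_cocycles c.2)
  let φ : cocycles G M 1 →+ (gMap γ τ (hT.normOp hM)).ker :=
    { toFun := fun c => ⟨(c.1 ![γ], c.1 ![τ]), hmem c⟩
      map_zero' := rfl
      map_add' := fun _ _ => rfl }
  let ψ := (QuotientAddGroup.mk'
    ((fMap M γ τ).range.addSubgroupOf (gMap γ τ (hT.normOp hM)).ker)).comp φ
  suffices h : Function.Surjective ψ ∧ ∀ c, ψ c = 0 ↔ c.1 ∈ coboundaries G M 1 by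
    obtain ⟨e, he⟩ := exists_equiv_of_surjective ψ h.1 h.2
    exact ⟨e, fun c => ⟨hmem c, he c⟩⟩
  refine ⟨fun x => ?_, fun c => ?_⟩
  · obtain ⟨⟨⟨x, y⟩, hxy⟩, rfl⟩ := QuotientAddGroup.mk'_surjective _ x
    obtain ⟨c, h, hc, hcγ, hcτ⟩ := hT.exists_crossedHom hM hxy
    refine ⟨⟨cochainOne c h, cochainOne_mem_cocycles_iff.2 hc⟩, ?_⟩
    exact congrArg _ (Subtype.ext (Prod.ext hcγ hcτ))
  · rw [AddMonoidHom.comp_apply, QuotientAddGroup.mk'_apply, QuotientAddGroup.eq_zero_iff,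
      AddSubgroup.mem_addSubgroupOf]
    change (∃ m, fMap M γ τ m = (c.1 ![γ], c.1 ![τ])) ↔ ∃ b, d G M 0 b = c.1
    constructor
    · rintro ⟨m, hm⟩
      have h0 := hT.crossedHom_ext (IsCrossedHom.coboundary m) (isCrossedHom_of_mem_cocycles c.2)
        (by fun_prop) (by fun_prop) (congrArg Prod.fst hm) (congrArg Prod.snd hm)
      refine ⟨⟨fun _ => m, continuous_const⟩, ?_⟩
      rw [eq_cochainOne c.1]
      ext g
      rw [d_apply, dFun_zero_apply]
      exact congrFun h0 (g 0)
    · rintro ⟨b, hb⟩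
      refine ⟨b ![], ?_⟩
      rw [← hb, d_apply, d_apply, dFun_zero_apply, dFun_zero_apply]
      rfl

/-- The value of `g` on a lift of a `2`-cocycle lies in `M`. -/
theorem gMap_isLift {c : Cochain G M 2} {F : G → Coind G M} (h : IsLift c F) :
    gMap γ τ (hT.normOp (Coind.isPadicModule hM)) (F γ, F τ) =
      Coind.ι (gMap γ τ (hT.normOp (Coind.isPadicModule hM)) (F γ, F τ) 1) := by
  rw [← Shift.pr_eq_zero_iff, hT.map_gMap (Coind.isPadicModule hM) (Shift.isPadicModule hM)
    Shift.pr Shift.continuous_pr Shift.pr_smul]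
  exact hT.gMap_eq_zero (Shift.isPadicModule hM) (c := fun g => Shift.pr (F g))
    (Shift.continuous_pr.comp h.continuous) h.pr

/-- Two lifts differ by a crossed homomorphism, which `g` kills. Hence `twoHom` may be computed on
any convenient lift. -/
theorem gMap_isLift_unique {c : Cochain G M 2} {F F' : G → Coind G M} (h : IsLift c F)
    (h' : IsLift c F') : gMap γ τ (hT.normOp (Coind.isPadicModule hM)) (F γ, F τ) =
      gMap γ τ (hT.normOp (Coind.isPadicModule hM)) (F' γ, F' τ) := by
  rw [← sub_eq_zero, ← map_sub, Prod.mk_sub_mk]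
  exact hT.gMap_eq_zero (Coind.isPadicModule hM) (c := fun g => F g - F' g)
    (h.continuous.sub h'.continuous) (h.sub h')

theorem gMap_ι (x : M × M) :
    gMap γ τ (hT.normOp (Coind.isPadicModule hM)) (Coind.ι x.1, Coind.ι x.2) =
      (Coind.ι (gMap γ τ (hT.normOp hM) x) : Coind G M) :=
  (hT.map_gMap hM (Coind.isPadicModule hM) Coind.ι Coind.continuous_ι Coind.ι_smul x).symm

/-- The homomorphism that induces the isomorphism of `H²(G, M)` with the cokernel of `g_M`. -/
noncomputable def twoHom : cocycles G M 2 →+ M ⧸ (gMap γ τ (hT.normOp hM)).range :=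
  -- The curried lift depends additively on `c`. The sign is what turns the value on normalised
  -- cocycles into `c(γ, γ⁻¹ τ γ) - c(τ, γ)`.
  AddMonoidHom.mk' (fun c => QuotientAddGroup.mk
    (-(gMap γ τ (hT.normOp (Coind.isPadicModule hM))
      (curryCochain c.1 ![γ], curryCochain c.1 ![τ]) 1))) fun c c' => by
    rw [← QuotientAddGroup.mk_add, ← neg_add, ← Coind.add_apply, ← map_add]
    rfl

theorem twoHom_eq (c : cocycles G M 2) {F : G → Coind G M} (h : IsLift c.1 F) :
    hT.twoHom hM c = QuotientAddGroup.mk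
      (-(gMap γ τ (hT.normOp (Coind.isPadicModule hM)) (F γ, F τ) 1)) := by
  rw [hT.gMap_isLift_unique hM h (isLift_curry c.2)]
  rfl

/-- Vanishing on `N × N` makes the lift a crossed homomorphism on `N`, so `gMap_eq` applies. In the
difference of the lift equations at `(γ, γ⁻¹ τ γ)` and `(τ, γ)` the terms `F(τ γ)` cancel. -/
theorem twoHom_eq_of_vanishing (c : cocycles G M 2) (hc : ∀ a ∈ N, ∀ b ∈ N, c.1 ![a, b] = 0) :
    hT.twoHom hM c = QuotientAddGroup.mk (c.1 ![γ, γ⁻¹ * τ * γ] - c.1 ![τ, γ]) := by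
  have h := isLift_curry c.2
  set F : G → Coind G M := fun g => curryCochain c.1 ![g]
  have hF : IsCrossedHom fun n : N => F n := fun a b => by
    have e := h.eq a b
    rw [hc a a.2 b b.2, map_zero, sub_add_eq_add_sub, sub_eq_zero] at e
    exact e.symm.trans (add_comm _ _)
  rw [hT.twoHom_eq hM c h, hT.gMap_eq (Coind.isPadicModule hM) h.continuous hF]
  have e1 := h.eq γ (γ⁻¹ * τ * γ)
  have e2 := h.eq τ γ
  rw [show γ * (γ⁻¹ * τ * γ) = τ * γ by group] at e1
  have e3 := congrArg (Coind.eval (1 : G)) (congrArg₂ (· - ·) e1 e2)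
  simp only [Coind.eval_apply, Coind.sub_apply, Coind.ι_apply, one_smul] at e3
  rw [← e3]
  simp only [Coind.add_apply, Coind.sub_apply]
  congr 1
  abel

theorem twoHom_eq_zero_iff (c : cocycles G M 2) :
    hT.twoHom hM c = 0 ↔ c.1 ∈ coboundaries G M 2 := by
  have hC := Coind.isPadicModule (G := G) hM
  constructor
  · intro h0
    have h := isLift_curry c.2
    set F : G → Coind G M := fun g => curryCochain c.1 ![g]
    rw [hT.twoHom_eq hM c h, QuotientAddGroup.eq_zero_iff] at h0
    obtain ⟨x, hx⟩ := neg_mem_iff.1 h0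
    have h1 : gMap γ τ (hT.normOp hC) (F γ - Coind.ι x.1, F τ - Coind.ι x.2) = 0 := by
      rw [← Prod.mk_sub_mk, map_sub, hT.gMap_ι hM, hx, ← hT.gMap_isLift hM h, sub_self]
    -- After correction by `x`, the values of `F` at `γ` and `τ` come from a crossed homomorphism
    -- `f`. Then `F - f` is a lift whose image in `Shift` vanishes at both generators, hence
    -- everywhere.
    obtain ⟨f, hf, hfc, hfγ, hfτ⟩ := hT.exists_crossedHom hC h1
    have h2 := h.sub_isCrossedHom hf hfc
    have h3 : Shift.pr ∘ (F - f) = 0 := by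
      refine hT.crossedHom_ext h2.pr (IsCrossedHom.coboundary (0 : Shift G M) |>.sub
        (IsCrossedHom.coboundary (0 : Shift G M)) |> fun h => by simpa using h)
        (Shift.continuous_pr.comp h2.continuous) continuous_const ?_ ?_
      · simp [hfγ]
      · simp [hfτ]
    exact ⟨_, (h2.eq_d ((Coind.continuous_apply 1).comp h2.continuous) fun g =>
      Shift.pr_eq_zero_iff.1 (congrFun h3 g)).symm⟩
  · rintro ⟨b, hb⟩
    rw [eq_cochainOne b] at hb
    have h := isLift_d (b := fun g => b ![g]) (by fun_prop)
    rw [hb] at h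
    rw [hT.twoHom_eq hM c h, hT.gMap_ι hM (b ![γ], b ![τ]), QuotientAddGroup.eq_zero_iff,
      neg_mem_iff, Coind.ι_apply, one_smul]
    exact ⟨_, rfl⟩

theorem twoHom_surjective : Function.Surjective (hT.twoHom hM) := by
  intro y
  obtain ⟨m, rfl⟩ := QuotientAddGroup.mk_surjective y
  have hC := Coind.isPadicModule (G := G) hM
  have hQ := Shift.isPadicModule (G := G) hM
  -- Thus `g(φ, 0) = -m`, so `(pr φ, 0)` is killed by `g` on `Shift` and comes from a crossed
  -- homomorphism `E`; its section is a lift of the required cocycle.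
  obtain ⟨φ, hφ⟩ := hT.exists_smul_sub_eq_coind hM (Coind.ι (-m))
  have h1 : gMap γ τ (hT.normOp hQ) (Shift.pr φ, 0) = 0 := by
    have := hT.map_gMap hC hQ Shift.pr Shift.continuous_pr Shift.pr_smul (φ, 0)
    rw [map_zero] at this
    rw [← this]
    simp [gMap, hφ]
  obtain ⟨E, hE, hEc, hEγ, hEτ⟩ := hT.exists_crossedHom hQ h1
  have hi := Shift.continuous_incl (G := G) (M := M)
  have hev := Coind.continuous_apply (M := M) (1 : G)
  let F : G → Coind G M := fun g => Shift.incl (E g)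
  have hF : Continuous F := hi.comp hE
  let c : Cochain G M 2 := ⟨fun g => (g 0 • F (g 1) - F (g 0 * g 1) + F (g 0)) 1,
    hev.comp (by fun_prop)⟩
  have h : IsLift c F :=
    { continuous := hF
      eq := fun a b => by
        refine Shift.pr_eq_zero_iff.1 ?_
        rw [map_add, map_sub, Shift.pr_smul, Shift.pr_incl, Shift.pr_incl, Shift.pr_incl, hEc a b]
        abel }
  refine ⟨⟨c, h.mem_cocycles⟩, ?_⟩
  rw [hT.twoHom_eq hM _ h]
  have e1 : F τ = 0 := by simp [F, hEτ]
  have e2 : F γ = φ - Coind.ι (φ 1) := by simp [F, hEγ]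
  have e3 : gMap γ τ (hT.normOp hC) (F γ, F τ) =
      Coind.ι (-m) - Coind.ι (τ • φ 1 - φ 1) := by
    rw [← hφ, e1, e2, map_sub Coind.ι, Coind.ι_smul]
    simp only [gMap, AddMonoidHom.coe_mk, ZeroHom.coe_mk, smul_zero, map_zero, smul_sub]
    abel
  rw [e3, QuotientAddGroup.eq]
  -- The section replaces `φ` by `φ - ι (φ 1)`, which changes the result by `(τ - 1) φ(1)`, an
  -- element of the image of `g_M`.
  refine ⟨(-(φ 1), 0), ?_⟩
  simp [gMap]
  abel

theorem exists_equiv_two : ∃ e₂ : H G M 2 ≃+ M ⧸ (gMap γ τ (hT.normOp hM)).range,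
    ∀ c : cocycles G M 2, (∀ a ∈ N, ∀ b ∈ N, c.1 ![a, b] = 0) →
      e₂ (cls c) = QuotientAddGroup.mk (c.1 ![γ, γ⁻¹ * τ * γ] - c.1 ![τ, γ]) := by
  obtain ⟨e, he⟩ := exists_equiv_of_surjective _ (hT.twoHom_surjective hM)
    (hT.twoHom_eq_zero_iff hM)
  exact ⟨e, fun c hc => (he c).trans (hT.twoHom_eq_of_vanishing hM c hc)⟩

theorem exists_vanishing_representative (x : H G M 2) :
    ∃ c : cocycles G M 2, (∀ a ∈ N, ∀ b ∈ N, c.1 ![a, b] = 0) ∧ cls c = x := by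
  obtain ⟨c, rfl⟩ := QuotientAddGroup.mk_surjective x
  have h := isLift_curry c.2
  set F : G → Coind G M := fun g => curryCochain c.1 ![g]
  -- On `N`, the images of `F` and `f` in `Shift` are crossed homomorphisms that agree at `τ`. So `F
  -- - f` is `M`-valued on `N`, and subtracting its boundary from `c` normalises the cocycle.
  obtain ⟨f, hf, hfc, hfτ⟩ := hT.exists_crossedHom_N (Coind.isPadicModule hM) (F τ)
  have hpr : (fun n : N => Shift.pr (F n)) = fun n => Shift.pr (f n) :=
    hT.crossedHom_ext_N (h.pr.restrict N)
      (hfc.comp_addMonoidHom Shift.pr fun n m => Shift.pr_smul (n : G) m)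
      (Shift.continuous_pr.comp (h.continuous.comp continuous_subtype_val))
      (Shift.continuous_pr.comp hf) (by simp [hfτ])
  -- The projection `G → N` serves only to extend this `M`-valued cochain continuously from `N` to
  -- `G`.
  obtain ⟨r, -, hr, -, -, hrm, -⟩ := hT.exists_decomp
  have hev := Coind.continuous_apply (M := M) (1 : G)
  have hFc := h.continuous
  let b : G → M := fun g => (F (r g) - f (r g)) 1
  have hb : Continuous b := hev.comp (by fun_prop)
  have hbN : ∀ n : N, F n = f n + Coind.ι (b n) := fun n => by
    have e1 : r n = n := by simpa using hrm n 1
    have e2 : Shift.pr (F n - f n) = 0 := by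
      rw [map_sub, sub_eq_zero]
      exact congrFun hpr n
    rw [Shift.pr_eq_zero_iff] at e2
    change F n = f n + Coind.ι ((F (r n) - f (r n)) 1)
    rw [e1, ← e2]
    abel
  refine ⟨⟨c.1 - d G M 1 (cochainOne b hb), sub_mem c.2 (d_d G M 1 _)⟩, fun x hx y hy => ?_, ?_⟩
  · change c.1 ![x, y] - d G M 1 (cochainOne b hb) ![x, y] = 0
    rw [sub_eq_zero]
    apply Coind.ι_injective (G := G)
    rw [← h.eq, d_cochainOne]
    change _ = Coind.ι (x • b y - b (x * y) + b x)
    have e1 := hbN ⟨x, hx⟩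
    have e2 := hbN ⟨y, hy⟩
    have e3 := hbN (⟨x, hx⟩ * ⟨y, hy⟩)
    rw [hfc] at e3
    simp only [Subgroup.coe_mul, Subgroup.smul_def] at e1 e2 e3
    rw [e1, e2, e3, map_add, map_sub, Coind.ι_smul, smul_add]
    abel
  · refine cls_eq_cls_iff.2 ?_
    change c.1 - (c.1 - d G M 1 (cochainOne b hb)) ∈ _
    rw [sub_sub_cancel]
    exact ⟨_, rfl⟩

theorem subsingleton_H_two_shift : Subsingleton (H G (Shift G M) 2) := by
  have hQ := Shift.isPadicModule (G := G) hM
  obtain ⟨e, -⟩ := hT.exists_equiv_two hQ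
  have : Subsingleton (Shift G M ⧸ (gMap γ τ (hT.normOp hQ)).range) := by
    rw [QuotientAddGroup.subsingleton_iff, AddMonoidHom.range_eq_top]
    intro f
    obtain ⟨φ, hφ⟩ := hT.exists_smul_sub_eq_shift hM f
    exact ⟨(φ, 0), by simpa [gMap] using hφ⟩
  exact e.toEquiv.subsingleton

end IsFalseTatePair

/-- `Shift G M` lives in universe `max u v`, which is stable under further shifts, so the induction
runs there; a general `M` is reached by one more shift. -/
theorem IsFalseTatePair.subsingleton_H_aux {G : Type u} [Group G] [TopologicalSpace G]
    [IsTopologicalGroup G] [CompactSpace G] [T2Space G] [FirstCountableTopology G] {p : ℕ}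
    [Fact p.Prime] {γ τ : G} {N K : Subgroup G} (hT : IsFalseTatePair p γ τ N K) (n : ℕ) :
    ∀ (M : Type max u v) [AddCommGroup M] [TopologicalSpace M] [NonarchimedeanAddGroup M]
      [T2Space M] [DistribMulAction G M] [ContinuousSMul G M], IsPadicModule p M →
      Subsingleton (H G M (n + 3)) := by
  induction n with
  | zero =>
    intro M _ _ _ _ _ _ hM
    exact subsingleton_H_of_shift (hT.subsingleton_H_two_shift hM)
  | succ n ih =>
    intro M _ _ _ _ _ _ hM
    exact subsingleton_H_of_shift (ih (Shift G M) (Shift.isPadicModule hM))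

theorem IsFalseTatePair.subsingleton_H {G : Type u} [Group G] [TopologicalSpace G]
    [IsTopologicalGroup G] [CompactSpace G] [T2Space G] [FirstCountableTopology G] {p : ℕ}
    [Fact p.Prime] {γ τ : G} {N K : Subgroup G} (hT : IsFalseTatePair p γ τ N K)
    {M : Type v} [AddCommGroup M] [TopologicalSpace M] [NonarchimedeanAddGroup M]
    [T2Space M] [DistribMulAction G M] [ContinuousSMul G M] (hM : IsPadicModule p M)
    {n : ℕ} (hn : 3 ≤ n) : Subsingleton (H G M n) := by
  obtain ⟨k, rfl⟩ := Nat.exists_eq_add_of_le' hn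
  cases k with
  | zero => exact subsingleton_H_of_shift (hT.subsingleton_H_two_shift hM)
  | succ k =>
    exact subsingleton_H_of_shift (hT.subsingleton_H_aux k (Shift G M) (Shift.isPadicModule hM))

/-! ### Degrees of cyclotomic extensions -/

section PadicCyclotomic

open Polynomial

variable (p : ℕ) [hp : Fact p.Prime]

/-- Eisenstein's criterion over `ℤ_p`: divisibility of the lower coefficients is inherited from `ℤ`,
and the constant term is `p`. Gauss's lemma passes to `ℚ_p`. -/
theorem irreducible_cyclotomic_prime_pow_comp_padic (n : ℕ) :
    Irreducible ((cyclotomic (p ^ (n + 1)) ℚ_[p]).comp (X + 1)) := by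
  have hX : (X + 1 : ℤ_[p][X]) = X + C 1 := by simp
  have hmonic : ((cyclotomic (p ^ (n + 1)) ℤ_[p]).comp (X + 1)).Monic := by
    rw [hX]
    exact (cyclotomic.monic _ _).comp (monic_X_add_C 1) (by rw [natDegree_X_add_C]; exact one_ne_zero)
  have hprime : (Ideal.span {(p : ℤ_[p])}).IsPrime :=
    (Ideal.span_singleton_prime (mod_cast hp.out.ne_zero)).2 PadicInt.prime_p
  have hmap : ((cyclotomic (p ^ (n + 1)) ℤ).comp (X + 1)).map (Int.castRingHom ℤ_[p]) =
      (cyclotomic (p ^ (n + 1)) ℤ_[p]).comp (X + 1) := by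
    simp [Polynomial.map_comp]
  have hdeg : ((cyclotomic (p ^ (n + 1)) ℤ_[p]).comp (X + 1)).natDegree =
      Nat.totient (p ^ (n + 1)) := by
    rw [natDegree_comp, hX, natDegree_X_add_C, mul_one, natDegree_cyclotomic]
  have hweak := (cyclotomic_prime_pow_comp_X_add_one_isEisensteinAt p n).isWeaklyEisensteinAt.map
    (Int.castRingHom ℤ_[p])
  rw [hmap] at hweak
  have hE : ((cyclotomic (p ^ (n + 1)) ℤ_[p]).comp (X + 1)).IsEisensteinAt
      (Ideal.span {(p : ℤ_[p])}) := by
    refine hmonic.isEisensteinAt_of_mem_of_notMem hprime.ne_top (fun {i} hi => ?_) ?_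
    · simpa [Ideal.map_span] using hweak.mem hi
    · rw [coeff_zero_eq_eval_zero, eval_comp, eval_add, eval_X, eval_one, zero_add,
        eval_one_cyclotomic_prime_pow, Ideal.span_singleton_pow, Ideal.mem_span_singleton, pow_two]
      intro h
      have h1 : (p : ℤ_[p]) * p ∣ p * 1 := by rwa [mul_one]
      exact PadicInt.prime_p.not_isUnit (isUnit_of_dvd_one
        ((mul_dvd_mul_iff_left (mod_cast hp.out.ne_zero)).1 h1))
  have hirr := hE.irreducible hprime hmonic.isPrimitive
    (by rw [hdeg]; exact Nat.totient_pos.2 (pow_pos hp.out.pos _))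
  have h := (hmonic.irreducible_iff_irreducible_map_fraction_map (K := ℚ_[p])).1 hirr
  simpa [Polynomial.map_comp] using h

theorem natDegree_minpoly_sub_one_padic {L : Type*} [Field L] [Algebra ℚ_[p] L] {n : ℕ} {ζ : L}
    (hζ : IsPrimitiveRoot ζ (p ^ (n + 1))) :
    (minpoly ℚ_[p] (ζ - 1)).natDegree = p ^ n * (p - 1) := by
  have hX : (X + 1 : ℚ_[p][X]) = X + C 1 := by simp
  have hmonic : ((cyclotomic (p ^ (n + 1)) ℚ_[p]).comp (X + 1)).Monic := by
    rw [hX]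
    exact (cyclotomic.monic _ _).comp (monic_X_add_C 1) (by rw [natDegree_X_add_C]; exact one_ne_zero)
  have hroot : aeval (ζ - 1) ((cyclotomic (p ^ (n + 1)) ℚ_[p]).comp (X + 1)) = 0 := by
    have h := hζ.isRoot_cyclotomic (pow_pos hp.out.pos _)
    rw [IsRoot.def, ← map_cyclotomic _ (algebraMap ℚ_[p] L), eval_map_algebraMap] at h
    rw [aeval_comp]
    simpa using h
  rw [← minpoly.eq_of_irreducible_of_monic (irreducible_cyclotomic_prime_pow_comp_padic p n) hroot
    hmonic, natDegree_comp, hX, natDegree_X_add_C, mul_one, natDegree_cyclotomic,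
    Nat.totient_prime_pow_succ hp.out]

/-- The degrees of the roots of unity of `p`-power order over a finite extension of `ℚ_p` are
unbounded. -/
theorem pow_mul_le_finrank_mul_natDegree {K L : Type*} [Field K] [Algebra ℚ_[p] K]
    [FiniteDimensional ℚ_[p] K] [Field L] [Algebra K L] {n : ℕ} {ζ : L}
    (hζ : IsPrimitiveRoot ζ (p ^ (n + 1))) :
    p ^ n * (p - 1) ≤ Module.finrank ℚ_[p] K * (minpoly K ζ).natDegree := by
  let : Algebra ℚ_[p] L := ((algebraMap K L).comp (algebraMap ℚ_[p] K)).toAlgebra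
  have : IsScalarTower ℚ_[p] K L := IsScalarTower.of_algebraMap_eq fun _ => rfl
  have hint : IsIntegral K ζ := (hζ.isIntegral (pow_pos hp.out.pos _)).tower_top
  have : FiniteDimensional K (IntermediateField.adjoin K {ζ}) :=
    IntermediateField.adjoin.finiteDimensional hint
  have : FiniteDimensional ℚ_[p] (IntermediateField.adjoin K {ζ}) :=
    FiniteDimensional.trans ℚ_[p] K _
  -- By the tower law the right side is `[K(ζ) : ℚ_p]`, which bounds the degree of its element `ζ -
  -- 1`.
  rw [← IntermediateField.adjoin.finrank hint, Module.finrank_mul_finrank,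
    ← natDegree_minpoly_sub_one_padic p hζ]
  have : IsScalarTower ℚ_[p] (IntermediateField.adjoin K {ζ}) L :=
    IsScalarTower.of_algebraMap_eq fun _ => rfl
  let x : IntermediateField.adjoin K {ζ} := IntermediateField.AdjoinSimple.gen K ζ - 1
  have hx : minpoly ℚ_[p] x = minpoly ℚ_[p] (ζ - 1) := by
    have := minpoly.algebraMap_eq (A := ℚ_[p]) (B := IntermediateField.adjoin K {ζ}) (B' := L)
      (algebraMap (IntermediateField.adjoin K {ζ}) L).injective x
    rw [← this]
    simp [x]
  rw [← hx]
  exact minpoly.natDegree_le x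

end PadicCyclotomic

/-- In a Galois extension the degree of `x` is the number of its conjugates. -/
theorem natDegree_minpoly_le_of_orbit {K L : Type*} [Field K] [Field L] [Algebra K L] [IsGalois K L]
    (x : L) {r : ℕ} (f : ℕ → L) (h : ∀ g : L ≃ₐ[K] L, ∃ i < r, g x = f i) :
    (minpoly K x).natDegree ≤ r := by
  rw [← Polynomial.card_rootSet_eq_natDegree (K := L) (IsGalois.separable K x) (IsGalois.splits K x),
    ← Nat.card_eq_fintype_card]
  classical
  have hsub : (minpoly K x).rootSet L ⊆ ((Finset.range r).image f : Finset L) := by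
    intro y hy
    obtain ⟨σ, rfl⟩ := minpoly.exists_algEquiv_of_root' (K := K) (L := L)
      (Algebra.IsAlgebraic.isAlgebraic x) (Polynomial.mem_rootSet.1 hy).2
    obtain ⟨i, hi, hx⟩ := h σ
    rw [hx, Finset.mem_coe, Finset.mem_image]
    exact ⟨i, Finset.mem_range.2 hi, rfl⟩
  calc _ = ((minpoly K x).rootSet L).ncard := rfl
    _ ≤ _ := Set.ncard_le_ncard hsub (Finset.finite_toSet _)
    _ ≤ r := by
      rw [Set.ncard_coe_finset]
      exact Finset.card_image_le.trans (Finset.card_range r).le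

/-! ### The field `L` and the topology of its Galois group -/

namespace FalseTate

section

variable {K Ω : Type*} [Field K] [Field Ω] [Algebra K Ω]

theorem mem_fixingSubgroup_restrict_adjoin_iff {L : IntermediateField K Ω} {S : Set Ω}
    (h : IntermediateField.adjoin K S ≤ L) (g : L ≃ₐ[K] L) :
    g ∈ (IntermediateField.restrict h).fixingSubgroup ↔ ∀ x : L, (x : Ω) ∈ S → g x = x := by
  rw [IntermediateField.mem_fixingSubgroup_iff]
  refine ⟨fun hg x hx => hg x ((IntermediateField.mem_restrict h x).2
    (IntermediateField.subset_adjoin K S hx)), fun hg x hx => ?_⟩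
  have hx' := (IntermediateField.mem_restrict h x).1 hx
  have e : (L.val.comp (g : L →ₐ[K] L)).comp (IntermediateField.inclusion h) =
      L.val.comp (IntermediateField.inclusion h) := by
    refine IntermediateField.adjoin_algHom_ext K fun y hy => ?_
    exact congrArg Subtype.val (hg ⟨y, h (IntermediateField.subset_adjoin K S hy)⟩ hy)
  exact Subtype.ext (AlgHom.congr_fun e ⟨(x : Ω), hx'⟩)

end

section

variable (K : Type*) [Field K] {Ω : Type*} [Field Ω] [Algebra K Ω] (ϖ ε : ℕ → Ω)

/-- `ϖ n` as an element of `L`. -/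
def kummerElt (n : ℕ) : field K ϖ ε :=
  ⟨ϖ n, (le_sup_left : kummerField K ϖ ≤ field K ϖ ε)
    (IntermediateField.subset_adjoin K _ ⟨n, rfl⟩)⟩

/-- `ε n` as an element of `L`. -/
def cyclElt (n : ℕ) : field K ϖ ε :=
  ⟨ε n, (le_sup_right : cyclField K ε ≤ field K ϖ ε)
    (IntermediateField.subset_adjoin K _ ⟨n, rfl⟩)⟩

variable {K ϖ ε}

theorem mem_galKummer_iff {g : Ginf K ϖ ε} :
    g ∈ galKummer K ϖ ε ↔ ∀ n, g (kummerElt K ϖ ε n) = kummerElt K ϖ ε n := by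
  refine (mem_fixingSubgroup_restrict_adjoin_iff _ g).trans ⟨fun h n => h _ ⟨n, rfl⟩, ?_⟩
  rintro h x ⟨n, hn⟩
  rw [show x = kummerElt K ϖ ε n from Subtype.ext hn.symm, h]

theorem mem_galCycl_iff {g : Ginf K ϖ ε} :
    g ∈ galCycl K ϖ ε ↔ ∀ n, g (cyclElt K ϖ ε n) = cyclElt K ϖ ε n := by
  refine (mem_fixingSubgroup_restrict_adjoin_iff _ g).trans ⟨fun h n => h _ ⟨n, rfl⟩, ?_⟩
  rintro h x ⟨n, hn⟩
  rw [show x = cyclElt K ϖ ε n from Subtype.ext hn.symm, h]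

theorem field_eq_adjoin : field K ϖ ε = IntermediateField.adjoin K (Set.range ϖ ∪ Set.range ε) := by
  rw [IntermediateField.adjoin_union]
  rfl

theorem ginf_ext {g g' : Ginf K ϖ ε}
    (h₁ : ∀ n, g (kummerElt K ϖ ε n) = g' (kummerElt K ϖ ε n))
    (h₂ : ∀ n, g (cyclElt K ϖ ε n) = g' (cyclElt K ϖ ε n)) : g = g' := by
  have e : (g : field K ϖ ε →ₐ[K] field K ϖ ε) = (g' : field K ϖ ε →ₐ[K] field K ϖ ε) := by
    refine IntermediateField.algHom_ext_of_eq_adjoin K field_eq_adjoin ?_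
    rintro x (⟨n, rfl⟩ | ⟨n, rfl⟩)
    · exact h₁ n
    · exact h₂ n
  exact AlgEquiv.ext fun x => DFunLike.congr_fun e x

variable (p : ℕ) [Fact p.Prime]

/-- Compatible systems `ϖ` and `ε` of `p`-power roots of a nonzero element of `K` and of unity. -/
structure IsCompatibleRoots (K : Type*) [Field K] {Ω : Type*} [Field Ω] [Algebra K Ω]
    (ϖ ε : ℕ → Ω) : Prop where
  ne_zero : ϖ 0 ≠ 0
  exists_eq : ∃ a : K, algebraMap K Ω a = ϖ 0
  ϖ_pow : ∀ n, ϖ (n + 1) ^ p = ϖ n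
  ε_prim : ∀ n, IsPrimitiveRoot (ε n) (p ^ n)
  ε_pow : ∀ n, ε (n + 1) ^ p = ε n

namespace IsCompatibleRoots

variable {p} (h : IsCompatibleRoots p K ϖ ε)

include h

theorem ϖ_add_pow (n k : ℕ) : ϖ (n + k) ^ p ^ k = ϖ n := by
  induction k with
  | zero => simp
  | succ k ih => rw [pow_succ', pow_mul, ← add_assoc, h.ϖ_pow, ih]

theorem kummerElt_add_pow (n k : ℕ) : kummerElt K ϖ ε (n + k) ^ p ^ k = kummerElt K ϖ ε n :=
  Subtype.ext (h.ϖ_add_pow n k)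

theorem cyclElt_prim (n : ℕ) : IsPrimitiveRoot (cyclElt K ϖ ε n) (p ^ n) :=
  IsPrimitiveRoot.of_map_of_injective (f := (field K ϖ ε).val) (h.ε_prim n) Subtype.val_injective

theorem ϖ_ne_zero (n : ℕ) : ϖ n ≠ 0 := fun h0 => h.ne_zero <| by
  rw [← h.ϖ_add_pow 0 n, zero_add, h0, zero_pow (pow_pos (Fact.out : p.Prime).pos n).ne']

theorem kummerElt_ne_zero (n : ℕ) : kummerElt K ϖ ε n ≠ 0 := fun h0 =>
  h.ϖ_ne_zero n (congrArg Subtype.val h0)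

/-- A conjugate of `ϖ n` is `ϖ n` times a power of `ε n`, because `ϖ n ^ p ^ n` lies in `K`; a
conjugate of `ε n` is a power of it. -/
theorem normal [Normal K Ω] : Normal K (field K ϖ ε) := by
  rw [IntermediateField.normal_iff_forall_map_le]
  intro σ
  rw [field_eq_adjoin, IntermediateField.adjoin_map, IntermediateField.adjoin_le_iff]
  have hp : ∀ n, NeZero (p ^ n) := fun n => ⟨(pow_pos (Fact.out : p.Prime).pos n).ne'⟩
  rw [← field_eq_adjoin]
  have hε : ∀ n i, ε n ^ i ∈ field K ϖ ε := fun n i => pow_mem (cyclElt K ϖ ε n).2 i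
  rintro _ ⟨_, ⟨n, rfl⟩ | ⟨n, rfl⟩, rfl⟩
  · have h1 : (σ (ϖ n) / ϖ n) ^ p ^ n = 1 := by
      have h2 := h.ϖ_add_pow 0 n
      rw [zero_add] at h2
      obtain ⟨a, ha⟩ := h.exists_eq
      rw [div_pow, ← map_pow, h2, ← ha]
      simp only [AlgHom.commutes]
      rw [ha, div_self h.ne_zero]
    obtain ⟨i, -, hi⟩ := (h.ε_prim n).eq_pow_of_pow_eq_one h1
    rw [eq_div_iff (h.ϖ_ne_zero n)] at hi
    change σ (ϖ n) ∈ _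
    rw [← hi]
    exact mul_mem (hε n i) (kummerElt K ϖ ε n).2
  · have h1 : σ (ε n) ^ p ^ n = 1 := by rw [← map_pow, (h.ε_prim n).pow_eq_one, map_one]
    obtain ⟨i, -, hi⟩ := (h.ε_prim n).eq_pow_of_pow_eq_one h1
    change σ (ε n) ∈ _
    rw [← hi]
    exact hε n i

theorem exists_apply_cyclElt (g : Ginf K ϖ ε) (n : ℕ) :
    ∃ i, g (cyclElt K ϖ ε n) = cyclElt K ϖ ε n ^ i := by
  have hp : NeZero (p ^ n) := ⟨(pow_pos (Fact.out : p.Prime).pos n).ne'⟩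
  have h1 : g (cyclElt K ϖ ε n) ^ p ^ n = 1 := by
    rw [← map_pow, (h.cyclElt_prim n).pow_eq_one, map_one]
  obtain ⟨i, -, hi⟩ := (h.cyclElt_prim n).eq_pow_of_pow_eq_one h1
  exact ⟨i, hi.symm⟩

theorem exists_apply_kummerElt (g : Ginf K ϖ ε) (n : ℕ) :
    ∃ i : ℕ, g (kummerElt K ϖ ε n) = cyclElt K ϖ ε n ^ i * kummerElt K ϖ ε n := by
  have hp : NeZero (p ^ n) := ⟨(pow_pos (Fact.out : p.Prime).pos n).ne'⟩
  have h1 : (g (kummerElt K ϖ ε n) / kummerElt K ϖ ε n) ^ p ^ n = 1 := by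
    have h2 := h.kummerElt_add_pow 0 n
    rw [zero_add] at h2
    obtain ⟨a, ha⟩ := h.exists_eq
    have ha' : algebraMap K (field K ϖ ε) a = kummerElt K ϖ ε 0 := Subtype.ext ha
    rw [div_pow, ← map_pow, h2, ← ha', AlgEquiv.commutes, ha', div_self (h.kummerElt_ne_zero 0)]
  obtain ⟨i, -, hi⟩ := (h.cyclElt_prim n).eq_pow_of_pow_eq_one h1
  exact ⟨i, by rw [hi, div_mul_cancel₀ _ (h.kummerElt_ne_zero n)]⟩

theorem galCycl_normal : (galCycl K ϖ ε).Normal where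
  conj_mem a ha g := by
    rw [mem_galCycl_iff] at ha ⊢
    intro n
    obtain ⟨i, hi⟩ := h.exists_apply_cyclElt g⁻¹ n
    rw [AlgEquiv.mul_apply, AlgEquiv.mul_apply, hi, map_pow, ha, ← hi, ← AlgEquiv.mul_apply,
      mul_inv_cancel, AlgEquiv.one_apply]

end IsCompatibleRoots

section Topology

variable [IsGalois K (field K ϖ ε)]

theorem continuous_apply_discrete [TopologicalSpace (field K ϖ ε)]
    [DiscreteTopology (field K ϖ ε)] (x : field K ϖ ε) :
    Continuous fun g : Ginf K ϖ ε => g x := by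
  have : ContinuousSMul (Ginf K ϖ ε) (field K ϖ ε) :=
    continuousSMul_iff_stabilizer_isOpen.2 fun x => stabilizer_isOpen_of_isIntegral x
  change Continuous fun g : Ginf K ϖ ε => g • x
  fun_prop

/-- An automorphism is determined by its values on countably many generators, so the compact group
embeds in a countable product of discrete spaces. First countability and the convergence criterion
follow. -/
theorem isInducing_apply [TopologicalSpace (field K ϖ ε)] [DiscreteTopology (field K ϖ ε)] :
    IsInducing fun (g : Ginf K ϖ ε) (n : ℕ) => (g (kummerElt K ϖ ε n), g (cyclElt K ϖ ε n)) := by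
  refine (Continuous.isClosedEmbedding (continuous_pi fun n =>
    (continuous_apply_discrete _).prodMk (continuous_apply_discrete _)) fun g g' hg => ?_).isInducing
  exact ginf_ext (fun n => congrArg Prod.fst (congrFun hg n))
    (fun n => congrArg Prod.snd (congrFun hg n))

theorem tendsto_ginf_iff {ι : Type*} {l : Filter ι} {f : ι → Ginf K ϖ ε} {g : Ginf K ϖ ε} :
    Tendsto f l (𝓝 g) ↔ ∀ n, (∀ᶠ i in l, f i (kummerElt K ϖ ε n) = g (kummerElt K ϖ ε n)) ∧
      ∀ᶠ i in l, f i (cyclElt K ϖ ε n) = g (cyclElt K ϖ ε n) := by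
  let : TopologicalSpace (field K ϖ ε) := ⊥
  have : DiscreteTopology (field K ϖ ε) := ⟨rfl⟩
  rw [isInducing_apply.tendsto_nhds_iff, tendsto_pi_nhds]
  refine forall_congr' fun n => ?_
  rw [nhds_prod_eq, tendsto_prod_iff', nhds_discrete, tendsto_pure, tendsto_pure]
  rfl

theorem firstCountableTopology_ginf : FirstCountableTopology (Ginf K ϖ ε) := by
  let : TopologicalSpace (field K ϖ ε) := ⊥
  have : DiscreteTopology (field K ϖ ε) := ⟨rfl⟩
  exact isInducing_apply.firstCountableTopology

theorem setOf_apply_eq_mem_nhds_one (x : field K ϖ ε) : {g : Ginf K ϖ ε | g x = x} ∈ 𝓝 1 := by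
  let : TopologicalSpace (field K ϖ ε) := ⊥
  have : DiscreteTopology (field K ϖ ε) := ⟨rfl⟩
  exact (continuous_apply_discrete x).continuousAt.preimage_mem_nhds
    ((isOpen_discrete {x}).mem_nhds rfl)

end Topology

end

end FalseTate

/-! ### The structure of `G_∞` -/

namespace FalseTate.IsCompatibleRoots

variable {K : Type*} [Field K] {Ω : Type*} [Field Ω] [Algebra K Ω] {ϖ ε : ℕ → Ω} {p : ℕ}
  [Fact p.Prime] (h : IsCompatibleRoots p K ϖ ε) {γ τ : Ginf K ϖ ε}

include h

theorem zpow_apply_kummerElt (hτ : τ ∈ galCycl K ϖ ε)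
    (hτ_one : ∀ n, τ (kummerElt K ϖ ε n) = cyclElt K ϖ ε n * kummerElt K ϖ ε n) (i : ℤ) (n : ℕ) :
    (τ ^ i) (kummerElt K ϖ ε n) = cyclElt K ϖ ε n ^ i * kummerElt K ϖ ε n := by
  have hε := mem_galCycl_iff.1 hτ n
  have he : cyclElt K ϖ ε n ≠ 0 :=
    (h.cyclElt_prim n).ne_zero (pow_pos (Fact.out : p.Prime).pos n).ne'
  induction i with
  | zero => simp
  | succ i ih =>
    rw [add_comm, zpow_one_add, AlgEquiv.mul_apply, ih, map_mul, map_zpow₀, hε, hτ_one,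
      zpow_one_add₀ he]
    ring
  | pred i ih =>
    apply τ.injective
    rw [← AlgEquiv.mul_apply, ← zpow_one_add, add_sub_cancel, ih, map_mul, map_zpow₀, hε, hτ_one,
      zpow_sub_one₀ he]
    field_simp

theorem pow_apply_kummerElt (hτ : τ ∈ galCycl K ϖ ε)
    (hτ_one : ∀ n, τ (kummerElt K ϖ ε n) = cyclElt K ϖ ε n * kummerElt K ϖ ε n) (i n : ℕ) :
    (τ ^ i) (kummerElt K ϖ ε n) = cyclElt K ϖ ε n ^ i * kummerElt K ϖ ε n := by
  simpa using h.zpow_apply_kummerElt hτ hτ_one i n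

theorem pow_totient_apply (g : Ginf K ϖ ε) (n : ℕ) :
    (g ^ Nat.totient (p ^ n)) (cyclElt K ϖ ε n) = cyclElt K ϖ ε n := by
  have hp : NeZero (p ^ n) := ⟨(pow_pos (Fact.out : p.Prime).pos n).ne'⟩
  have hζ := h.cyclElt_prim n
  rw [← hζ.autToPow_spec K, map_pow, ZMod.pow_totient, ← map_one (hζ.autToPow K),
    hζ.autToPow_spec K, AlgEquiv.one_apply]

theorem apply_cyclElt_eq_pow_chi (g : Ginf K ϖ ε) (n : ℕ) :
    g (cyclElt K ϖ ε n) =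
      cyclElt K ϖ ε n ^ (PadicInt.toZModPow n (chi p g : ℤ_[p])).val := by
  have hp : ∀ i, NeZero (p ^ i) := fun i => ⟨(pow_pos (Fact.out : p.Prime).pos i).ne'⟩
  have : ∀ i, HasEnoughRootsOfUnity (field K ϖ ε) (p ^ i) := fun i =>
    ⟨⟨_, h.cyclElt_prim i⟩, rootsOfUnity.isCyclic _ _⟩
  exact cyclotomicCharacter.spec p g.toRingEquiv (cyclElt K ϖ ε n) (h.cyclElt_prim n).pow_eq_one

variable [IsGalois K (field K ϖ ε)]

theorem isPadicGenerator_τ (hτ : τ ∈ galCycl K ϖ ε)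
    (hτ_one : ∀ n, τ (kummerElt K ϖ ε n) = cyclElt K ϖ ε n * kummerElt K ϖ ε n) :
    IsPadicGenerator p τ := fun j => by
  refine ⟨_, setOf_apply_eq_mem_nhds_one (kummerElt K ϖ ε j), fun n hn => ?_⟩
  rw [Set.mem_ofPred_eq, h.zpow_apply_kummerElt hτ hτ_one,
    mul_eq_right₀ (h.kummerElt_ne_zero j)] at hn
  exact ((h.cyclElt_prim j).zpow_eq_one_iff_dvd n).1 hn

/-- Write `g(ϖ n) = ε n ^ i n * ϖ n`. Then `τ ^ i k` agrees with `g` on `ϖ n` for all `n ≤ k`, and a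
limit point of these powers agrees with `g` on all of `K_∞`. -/
theorem exists_mul_eq (hτ : τ ∈ galCycl K ϖ ε)
    (hτ_one : ∀ n, τ (kummerElt K ϖ ε n) = cyclElt K ϖ ε n * kummerElt K ϖ ε n)
    (g : Ginf K ϖ ε) : ∃ a ∈ galCycl K ϖ ε, ∃ b ∈ galKummer K ϖ ε, a * b = g := by
  choose i hi using h.exists_apply_kummerElt g
  have hi' : ∀ n k, n ≤ k → (τ ^ i k) (kummerElt K ϖ ε n) = g (kummerElt K ϖ ε n) := by
    intro n k hnk
    obtain ⟨d, rfl⟩ := Nat.exists_eq_add_of_le hnk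
    rw [← h.kummerElt_add_pow n d, map_pow, map_pow, hi, h.pow_apply_kummerElt hτ hτ_one]
  have := firstCountableTopology_ginf (K := K) (ϖ := ϖ) (ε := ε)
  obtain ⟨a, φ, hφ, ha⟩ := CompactSpace.tendsto_subseq fun k : ℕ => τ ^ i k
  rw [tendsto_ginf_iff] at ha
  have haN : a ∈ galCycl K ϖ ε := by
    rw [mem_galCycl_iff]
    intro n
    obtain ⟨k, hk⟩ := (ha n).2.exists
    rw [← hk]
    exact mem_galCycl_iff.1 (pow_mem hτ _) n
  refine ⟨a, haN, a⁻¹ * g, ?_, mul_inv_cancel_left a g⟩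
  rw [mem_galKummer_iff]
  intro n
  obtain ⟨k, hk, hnk⟩ := ((ha n).1.and (eventually_ge_atTop n)).exists
  rw [AlgEquiv.mul_apply, ← hi' n (φ k) (hnk.trans (hφ.id_le k))]
  apply a.injective
  rw [← AlgEquiv.mul_apply, mul_inv_cancel, AlgEquiv.one_apply]
  exact hk

/-- Otherwise a fixed power of `γ` is trivial, so `Gal(L/K_∞)` is finite. As `Gal(L/K_cycl)` fixes
roots of unity, their Galois orbits are then bounded, which contradicts the growth of their degrees
over `K`. -/
theorem isPadicGenerator_γ [Algebra ℚ_[p] K] [FiniteDimensional ℚ_[p] K]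
    (hγ : (Subgroup.zpowers γ).topologicalClosure = galKummer K ϖ ε)
    (hmul : ∀ g : Ginf K ϖ ε, ∃ a ∈ galCycl K ϖ ε, ∃ b ∈ galKummer K ϖ ε, a * b = g) :
    IsPadicGenerator p γ := by
  have hpp : p.Prime := Fact.out
  by_contra hcon
  simp only [IsPadicGenerator, not_forall, not_exists, not_and] at hcon
  obtain ⟨j, hj⟩ := hcon
  set r := p ^ j * (p - 1)
  have hr : 0 < r := Nat.mul_pos (pow_pos hpp.pos j) (Nat.sub_pos_of_lt hpp.one_lt)
  -- a fixed power of `γ` acts trivially on all roots of unity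
  have hfix : ∀ k, (γ ^ r) (cyclElt K ϖ ε k) = cyclElt K ϖ ε k := by
    intro k
    cases k with
    | zero =>
      have h1 : cyclElt K ϖ ε 0 = 1 := by
        have := h.cyclElt_prim 0
        rwa [pow_zero, IsPrimitiveRoot.one_right_iff] at this
      rw [h1, map_one]
    | succ k =>
      obtain ⟨n, hn, hpn⟩ := hj _ (setOf_apply_eq_mem_nhds_one (cyclElt K ϖ ε (k + 1)))
      let S := MulAction.stabilizer (Ginf K ϖ ε) (cyclElt K ϖ ε (k + 1))
      have h1 : γ ^ n ∈ S := hn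
      have h2 : γ ^ ((p ^ k * (p - 1) : ℕ) : ℤ) ∈ S := by
        rw [zpow_natCast, ← Nat.totient_prime_pow_succ hpp]
        exact h.pow_totient_apply γ (k + 1)
      have h3 : γ ^ ((Int.gcd n (p ^ k * (p - 1) : ℕ) : ℕ) : ℤ) ∈ S := by
        rw [Int.gcd_eq_gcd_ab, zpow_add, zpow_mul, zpow_mul]
        exact S.mul_mem (S.zpow_mem h1 _) (S.zpow_mem h2 _)
      -- Since `p ^ j ∤ n`, the `p`-power `gcd(n, p ^ k)` divides `p ^ j`; the factor `p - 1`
      -- contributes at most itself. The bound `r` is therefore independent of `k`.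
      have h4 : Int.gcd n (p ^ k * (p - 1) : ℕ) ∣ r := by
        rw [Int.gcd, Int.natAbs_natCast]
        refine (Nat.gcd_mul_right_dvd_mul_gcd _ _ _).trans (Nat.mul_dvd_mul ?_ (Nat.gcd_dvd_right _ _))
        obtain ⟨i, -, hi⟩ := (Nat.dvd_prime_pow hpp).1 (Nat.gcd_dvd_right n.natAbs (p ^ k))
        rw [hi]
        refine pow_dvd_pow p (le_of_not_gt fun hji => hpn ?_)
        rw [Int.natCast_dvd]
        exact (pow_dvd_pow p hji.le).trans (hi ▸ Nat.gcd_dvd_left _ _)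
      obtain ⟨q, hq⟩ := h4
      have h5 : γ ^ r ∈ S := by
        rw [zpow_natCast] at h3
        rw [hq, pow_mul]
        exact S.pow_mem h3 q
      exact h5
  have hγK : γ ∈ galKummer K ϖ ε := mem_of_closure_zpowers_eq hγ
  have hγr : γ ^ r = 1 := ginf_ext (fun n => mem_galKummer_iff.1 (pow_mem hγK r) n) hfix
  have hfin : (Subgroup.zpowers γ : Set (Ginf K ϖ ε)).Finite :=
    (isOfFinOrder_iff_pow_eq_one.2 ⟨r, hr, hγr⟩).finite_zpowers
  have hcl : (galKummer K ϖ ε : Set (Ginf K ϖ ε)) = Subgroup.zpowers γ := by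
    rw [← hγ, Subgroup.topologicalClosure_coe, hfin.isClosed.closure_eq]
  have horb : ∀ (k : ℕ) (g : Ginf K ϖ ε), ∃ i < r,
      g (cyclElt K ϖ ε k) = (γ ^ i) (cyclElt K ϖ ε k) := by
    intro k g
    obtain ⟨a, ha, b, hb, rfl⟩ := hmul g
    have hb' : b ∈ (galKummer K ϖ ε : Set (Ginf K ϖ ε)) := hb
    rw [hcl] at hb'
    obtain ⟨m, rfl⟩ := hb'
    have hmr : (0 : ℤ) ≤ m % r := Int.emod_nonneg _ (by exact_mod_cast hr.ne')
    have hpow : γ ^ m = γ ^ (m % r).toNat := by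
      rw [← zpow_natCast, Int.toNat_of_nonneg hmr]
      conv_lhs => rw [← Int.emod_add_mul_ediv m r, zpow_add, zpow_mul, zpow_natCast γ r, hγr,
        one_zpow, mul_one]
    refine ⟨(m % r).toNat, ?_, ?_⟩
    · rw [Int.toNat_lt hmr]
      exact Int.emod_lt_of_pos m (by exact_mod_cast hr)
    · obtain ⟨i, hi⟩ := h.exists_apply_cyclElt (γ ^ m) k
      change a ((γ ^ m) _) = _
      rw [← hpow, hi, map_pow, mem_galCycl_iff.1 ha]
  have hbound : ∀ k, p ^ k * (p - 1) ≤ Module.finrank ℚ_[p] K * r := fun k =>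
    (pow_mul_le_finrank_mul_natDegree p (h.cyclElt_prim (k + 1))).trans
      (Nat.mul_le_mul_left _ (natDegree_minpoly_le_of_orbit _ _ (horb (k + 1))))
  -- Any `k` with `p ^ k` above the bound works, and `p ^ k > k` lets the bound itself serve as `k`.
  have h1 := hbound (Module.finrank ℚ_[p] K * r)
  have h2 := Nat.lt_pow_self hpp.one_lt (n := Module.finrank ℚ_[p] K * r)
  have h3 : p ^ (Module.finrank ℚ_[p] K * r) ≤ p ^ (Module.finrank ℚ_[p] K * r) * (p - 1) :=
    Nat.le_mul_of_pos_right _ (Nat.sub_pos_of_lt hpp.one_lt)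
  omega

theorem isFalseTatePair [Algebra ℚ_[p] K] [FiniteDimensional ℚ_[p] K]
    (hγ : (Subgroup.zpowers γ).topologicalClosure = galKummer K ϖ ε)
    (hτ : (Subgroup.zpowers τ).topologicalClosure = galCycl K ϖ ε)
    (hτ_one : ∀ n, τ (kummerElt K ϖ ε n) = cyclElt K ϖ ε n * kummerElt K ϖ ε n) :
    IsFalseTatePair p γ τ (galCycl K ϖ ε) (galKummer K ϖ ε) :=
  have hτN := mem_of_closure_zpowers_eq hτ
  have hmul := h.exists_mul_eq hτN hτ_one
  { closure_γ := hγ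
    closure_τ := hτ
    normal := h.galCycl_normal
    disjoint := by
      rw [Subgroup.disjoint_def]
      intro g hg hg'
      exact ginf_ext (mem_galKummer_iff.1 hg') (mem_galCycl_iff.1 hg)
    exists_mul := hmul
    padic_γ := h.isPadicGenerator_γ hγ hmul
    padic_τ := h.isPadicGenerator_τ hτN hτ_one }

/-- Since `γ` fixes `ϖ n`, the conjugate `γ τ γ⁻¹` multiplies it by `γ(ε n) = ε n ^ χ(γ)`, while `τ
^ s` multiplies it by `ε n ^ s`. These agree once `s ≡ χ(γ)` modulo `p ^ n`. -/
theorem tendsto_pow_of_tendsto_chi (hγ : γ ∈ galKummer K ϖ ε) (hτ : τ ∈ galCycl K ϖ ε)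
    (hτ_one : ∀ n, τ (kummerElt K ϖ ε n) = cyclElt K ϖ ε n * kummerElt K ϖ ε n) {s : ℕ → ℕ}
    (hs : Tendsto (fun n => (s n : ℤ_[p])) atTop (𝓝 (chi p γ : ℤ_[p]))) :
    Tendsto (fun n => τ ^ s n) atTop (𝓝 (γ * τ * γ⁻¹)) := by
  have hp : ∀ i, NeZero (p ^ i) := fun i => ⟨(pow_pos (Fact.out : p.Prime).pos i).ne'⟩
  rw [tendsto_ginf_iff]
  refine fun n => ⟨?_, Eventually.of_forall fun i => ?_⟩
  · have hγ' : γ⁻¹ (kummerElt K ϖ ε n) = kummerElt K ϖ ε n :=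
      mem_galKummer_iff.1 (inv_mem hγ) n
    have hmod : ∀ᶠ i in atTop, PadicInt.toZModPow n (chi p γ : ℤ_[p]) = (s i : ZMod (p ^ n)) := by
      have hball := hs.eventually (Metric.ball_mem_nhds _
        (zpow_pos (show (0 : ℝ) < p by exact_mod_cast (Fact.out : p.Prime).pos) (-n : ℤ)))
      filter_upwards [hball] with i hi
      rw [dist_eq_norm] at hi
      have h1 := (PadicInt.norm_le_pow_iff_mem_span_pow _ n).1 hi.le
      rw [← PadicInt.ker_toZModPow, RingHom.mem_ker, map_sub, map_natCast, sub_eq_zero] at h1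
      exact h1.symm
    filter_upwards [hmod] with i hi
    rw [AlgEquiv.mul_apply, AlgEquiv.mul_apply, hγ', hτ_one, map_mul,
      mem_galKummer_iff.1 hγ, h.apply_cyclElt_eq_pow_chi, hi, ZMod.val_natCast,
      h.pow_apply_kummerElt hτ hτ_one]
    congr 1
    conv_lhs => rw [← Nat.mod_add_div (s i) (p ^ n), pow_add, pow_mul,
      (h.cyclElt_prim n).pow_eq_one, one_pow, mul_one]
  · rw [mem_galCycl_iff.1 (pow_mem hτ _),
      mem_galCycl_iff.1 (h.galCycl_normal.conj_mem _ hτ γ)]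

end FalseTate.IsCompatibleRoots

/-! ### The main theorem -/

theorem mainTheorem4
    (p : ℕ) [Fact p.Prime] (hp : p ≠ 2)
    -- a finite extension `K` of `ℚ_p` with an algebraic closure and a uniformizer
    (K : Type*) [Field K] [Algebra ℚ_[p] K] [FiniteDimensional ℚ_[p] K]
    [Algebra ℤ_[p] K] [IsScalarTower ℤ_[p] ℚ_[p] K]
    (Ω : Type*) [Field Ω] [Algebra K Ω] [IsAlgClosure K Ω]
    (π : integralClosure ℤ_[p] K) (hπ : Irreducible π)
    -- compatible systems of `p`-power roots of the uniformizer and of unity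
    (ϖ : ℕ → Ω) (hϖ_zero : ϖ 0 = algebraMap K Ω (π : K)) (hϖ : ∀ n, ϖ (n + 1) ^ p = ϖ n)
    (ε : ℕ → Ω) (hε_prim : ∀ n, IsPrimitiveRoot (ε n) (p ^ n)) (hε : ∀ n, ε (n + 1) ^ p = ε n)
    -- topological generators `γ` of `Gal(L/K_∞)` and `τ` of `Gal(L/K_cycl)`
    (γ τ : FalseTate.Ginf K ϖ ε)
    (hγ : (Subgroup.zpowers γ).topologicalClosure = FalseTate.galKummer K ϖ ε)
    (hτ : (Subgroup.zpowers τ).topologicalClosure = FalseTate.galCycl K ϖ ε)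
    (hτ_one : ∀ (n : ℕ) (x : FalseTate.field K ϖ ε), (x : Ω) = ϖ n → (τ x : Ω) = ε n * ϖ n)
    -- a `p`-adic topological abelian group `M` with a continuous action of `G_∞`
    (M : Type*) [AddCommGroup M] [TopologicalSpace M] [NonarchimedeanAddGroup M] [T2Space M]
    (hM : IsPadicModule p M)
    [DistribMulAction (FalseTate.Ginf K ϖ ε) M] [ContinuousSMul (FalseTate.Ginf K ϖ ε) M] :
    ∃ δ : M ≃+ M,
      FalseTate.IsNormOperator p τ (FalseTate.chi p γ : ℤ_[p]) δ ∧
      -- the sequence is a complex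
      (FalseTate.gMap γ τ δ).comp (FalseTate.fMap M γ τ) = 0 ∧
      -- degree `0`
      (∃ e₀ : ContCohomology.H (FalseTate.Ginf K ϖ ε) M 0 ≃+ (FalseTate.fMap M γ τ).ker,
        ∀ c : ContCohomology.cocycles (FalseTate.Ginf K ϖ ε) M 0,
          (e₀ (ContCohomology.cls c) : M) = c.1 ![]) ∧
      -- degree `1`
      (∃ e₁ : ContCohomology.H (FalseTate.Ginf K ϖ ε) M 1 ≃+
          (FalseTate.gMap γ τ δ).ker ⧸
            (FalseTate.fMap M γ τ).range.addSubgroupOf (FalseTate.gMap γ τ δ).ker,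
        ∀ c : ContCohomology.cocycles (FalseTate.Ginf K ϖ ε) M 1,
          ∃ h : (c.1 ![γ], c.1 ![τ]) ∈ (FalseTate.gMap γ τ δ).ker,
            e₁ (ContCohomology.cls c) = QuotientAddGroup.mk ⟨(c.1 ![γ], c.1 ![τ]), h⟩) ∧
      -- degree `2`: every class has a representative vanishing on `Gal(L/K_cycl) ^ 2`, and the
      -- isomorphism is computed on such representatives
      (∀ x : ContCohomology.H (FalseTate.Ginf K ϖ ε) M 2,
        ∃ c : ContCohomology.cocycles (FalseTate.Ginf K ϖ ε) M 2,
          (∀ a ∈ FalseTate.galCycl K ϖ ε, ∀ b ∈ FalseTate.galCycl K ϖ ε, c.1 ![a, b] = 0) ∧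
          ContCohomology.cls c = x) ∧
      (∃ e₂ : ContCohomology.H (FalseTate.Ginf K ϖ ε) M 2 ≃+ M ⧸ (FalseTate.gMap γ τ δ).range,
        ∀ c : ContCohomology.cocycles (FalseTate.Ginf K ϖ ε) M 2,
          (∀ a ∈ FalseTate.galCycl K ϖ ε, ∀ b ∈ FalseTate.galCycl K ϖ ε, c.1 ![a, b] = 0) →
          e₂ (ContCohomology.cls c) =
            QuotientAddGroup.mk (c.1 ![γ, γ⁻¹ * τ * γ] - c.1 ![τ, γ])) ∧
      -- higher degrees
      (∀ n : ℕ, 3 ≤ n → Subsingleton (ContCohomology.H (FalseTate.Ginf K ϖ ε) M n)) := by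
  have : CharZero K := charZero_of_injective_algebraMap (algebraMap ℚ_[p] K).injective
  have : Normal K Ω := IsAlgClosure.normal K Ω
  have h : FalseTate.IsCompatibleRoots p K ϖ ε :=
    { ne_zero := by
        rw [hϖ_zero, Ne, map_eq_zero, ZeroMemClass.coe_eq_zero]
        exact hπ.ne_zero
      exists_eq := ⟨_, hϖ_zero.symm⟩
      ϖ_pow := hϖ
      ε_prim := hε_prim
      ε_pow := hε }
  have : Normal K (FalseTate.field K ϖ ε) := h.normal
  have : IsGalois K (FalseTate.field K ϖ ε) := ⟨⟩
  have : FirstCountableTopology (FalseTate.Ginf K ϖ ε) := FalseTate.firstCountableTopology_ginf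
  have hτ_one' : ∀ n, τ (FalseTate.kummerElt K ϖ ε n) =
      FalseTate.cyclElt K ϖ ε n * FalseTate.kummerElt K ϖ ε n := fun n =>
    Subtype.ext (hτ_one n _ rfl)
  have hT := h.isFalseTatePair hγ hτ hτ_one'
  exact ⟨hT.normOp hM,
    hT.isNormOperator hM fun s hs => h.tendsto_pow_of_tendsto_chi hT.γ_mem hT.τ_mem hτ_one' hs,
    hT.gMap_comp_fMap hM, hT.exists_equiv_zero, hT.exists_equiv_one hM,
    hT.exists_vanishing_representative hM, hT.exists_equiv_two hM,
    fun n hn => hT.subsingleton_H hM hn⟩
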